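/- For $\omega,\omega'\in\mathbb{C}$ linearly independent over $\mathbb{R}$ let $\wp(z|\omega,\omega')$ be the Weierstrass function with period lattice $2\omega\mathbb{Z}+2\omega'\mathbb{Z}$ (so $\omega,\omega'$ are half-periods), and for $\tau\in\mathbb{C}$ with $\operatorname{Im}\tau\neq 0$ let $$x(\tau)=\frac{\wp(1|2,2\tau)-\wp(2|2,2\tau)}{\wp(\tau|2,2\tau)-\wp(2|2,2\tau)}$$ be Burnside's function. Then the general multivalued solution of the Fuchsian equation $$\Psi_{xx}=-\frac14\,\frac{x^8+14x^4+1}{(x^5-x)^2}\,\Psi \qquad (*)$$ is $$\Psi(x)=\sqrt{\frac{x^5-x}{x^4-5}}\,\sqrt{\wp\big(\tau(x)|2,2\tau(x)\big)}\,\big(A\,\tau(x)+B\big),\qquad A,B\in\mathbb{C},$$ where the multivalued function $\tau(x)$ is the inverse of $x(\tau)$. Precisely, let $S=\{0,\pm1,\pm i\}$ be the set of zeros of $x^5-x$. 1. The set of values of $x(\tau)$, $\operatorname{Im}\tau\ne0$, is exactly $\mathbb{C}\setminus S$. 2. Let $U\subseteq\mathbb{C}\setminus S$ be open and simply connected, $x_0\in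 U$, $\operatorname{Im}\tau_0\neq0$ and $x(\tau_0)=x_0$. Then there is exactly one holomorphic branch of $\tau(x)$ on $U$, that is, one holomorphic $t:U\to\mathbb{C}\setminus\mathbb{R}$ with $x(t(u))=u$ for all $u\in U$, such that $t(x_0)=\tau_0$; and there is a holomorphic branch on $U$ of the product of roots, that is, a holomorphic $w:U\to\mathbb{C}$ such that for every $u\in U$ with $u^4\neq5$ the value $w(u)$ is a product of a square root of $\frac{u^5-u}{u^4-5}$ and a square root of $\wp(t(u)|2,2t(u))$. 3. Let $U\subseteq\mathbb{C}\setminus S$ be open, connected and non-empty, $t$ any holomorphic branch of $\tau(x)$ on $U$, and $w$ any holomorphic branch on $U$ of the corresponding product of roots. Then for all $A,B\in\mathbb{C}$ the function $w\cdot(A\,t+B)$ is a holomorphic solution of $(*)$ on $U$, and every holomorphic solution $\Psi$ of $(*)$ on $U$ is $\Psi=w\cdot(A\,t+B)$ for exactly one pair $(A,B)\in\mathbb{C}^2$. -/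

import Mathlib

/-- The Weierstrass function `℘(z | ω, ω')` with half-periods `ω, ω'`, that is, with period lattice
`2ω ℤ + 2ω' ℤ`. The value `0` when `ω, ω'` are linearly dependent over `ℝ` is a dummy value. -/
noncomputable def wp (z ω ω' : ℂ) : ℂ :=
  open Classical in
  if h : LinearIndependent ℝ ![2 * ω, 2 * ω'] then
    (PeriodPair.mk (2 * ω) (2 * ω') h).weierstrassP z
  else 0

/-- The half-periods `2, 2τ` are admissible when `τ` is not real. -/
theorem linearIndependent_periods {τ : ℂ} (hτ : τ.im ≠ 0) :
    LinearIndependent ℝ ![2 * (2 : ℂ), 2 * (2 * τ)] := by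
  refine LinearIndependent.pair_iff.mpr fun s t h => ?_
  have him := congrArg Complex.im h
  have hre := congrArg Complex.re h
  simp at him hre
  have ht : t = 0 := by tauto
  subst ht
  simpa using hre

/-- Hence `wp z 2 (2 * τ)` is the Weierstrass function of the lattice `4ℤ + 4τℤ`. -/
theorem wp_eq_weierstrassP {τ : ℂ} (hτ : τ.im ≠ 0) (z : ℂ) :
    wp z 2 (2 * τ) =
      (PeriodPair.mk (2 * 2) (2 * (2 * τ)) (linearIndependent_periods hτ)).weierstrassP z := by
  simp only [wp, dif_pos (linearIndependent_periods hτ)]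

/-- Burnside's function `x(τ) = (℘(1) - ℘(2)) / (℘(τ) - ℘(2))`, where `℘ = ℘(· | 2, 2τ)`;
it is meaningful for `τ` with nonzero imaginary part. -/
noncomputable def burnsideX (τ : ℂ) : ℂ :=
  (wp 1 2 (2 * τ) - wp 2 2 (2 * τ)) / (wp τ 2 (2 * τ) - wp 2 2 (2 * τ))

/-- `t` is a (single-valued, holomorphic) branch on `U` of the multivalued inverse `τ(x)` of
Burnside's function. -/
structure IsInverseBranch (U : Set ℂ) (t : ℂ → ℂ) : Prop where
  holo : DifferentiableOn ℂ t U
  im_ne : ∀ x ∈ U, (t x).im ≠ 0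
  inv : ∀ x ∈ U, burnsideX (t x) = x

/-- `w` is a holomorphic branch on `U` of the product
`√((x⁵ - x) / (x⁴ - 5)) · √(℘(τ(x) | 2, 2τ(x)))`, where `t` is the chosen branch of `τ(x)`.
At the points with `x⁴ = 5`, where the first radicand has a pole and the second one a zero,
the product is understood by holomorphic extension. -/
structure IsRootBranch (U : Set ℂ) (t w : ℂ → ℂ) : Prop where
  holo : DifferentiableOn ℂ w U
  root : ∀ x ∈ U, x ^ 4 ≠ 5 → ∃ r s : ℂ,
    r ^ 2 = (x ^ 5 - x) / (x ^ 4 - 5) ∧ s ^ 2 = wp (t x) 2 (2 * t x) ∧ w x = r * s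

/-- `Ψ` is a holomorphic solution on the open set `U` of
`Ψ_xx = -¼ (x⁸ + 14x⁴ + 1) / (x⁵ - x)² Ψ`. -/
structure IsFuchsSolution (U : Set ℂ) (Ψ : ℂ → ℂ) : Prop where
  holo : DifferentiableOn ℂ Ψ U
  ode : ∀ x ∈ U, deriv (deriv Ψ) x =
    -(1 / 4) * ((x ^ 8 + 14 * x ^ 4 + 1) / (x ^ 5 - x) ^ 2) * Ψ x

/-! Let `e₀, e₁, e₂` be the values of `℘` at the half-periods `2, 2 + 2τ, 2τ`, let `λ = (e₁ - e₂) /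
(e₀ - e₂)` and `β(x) = ((x² - 1) / (x² + 1))²`. For a half-period `h` the product `(℘(z) - ℘(h))
(℘(z - h) - ℘(h))` is constant in `z`, so `℘(1)` and `℘(τ)` are, up to shifts by the `eᵢ`, square
roots of products of differences `eᵢ - eⱼ`. This algebra (`burnsideX_spec`) shows that `x(τ)` avoids
the zeros of `x⁵ - x`, that `λ(τ) = β(x(τ))`, and that the product of the two radicands is `(e₀ -
e₂) x (x² - 1) / (3 (x² + 1))`, which has neither zero nor pole, even where `x⁴ = 5`.

Values and branches: `λ` covers `ℂ \ {0, 1}` (`isCoveringMapOn_modularLambda`) and `β` is locally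
biholomorphic off the singular points. Lifting `β ∘ f` through `λ` produces a map into the
half-plane, and uniqueness of lifts through `β` shows that it also lifts `f` through Burnside's
function (`exists_lift_burnsideX`).

The equation: `λ' = c λ (1 - λ) (e₀ - e₂)` turns `λ(t(x)) = β(x)` into a formula for `t'`, from
which `w² t'` is constant. Hence `w` and `w t` solve one equation `y'' = Q y` with `Q = w'' / w`
(`reduction_of_order`). A Riccati equation for `(e₀ - e₂)' / (e₀ - e₂)` evaluates `Q` as a rational
function of `x`. Both differential relations (`exists_halphen_system`) hold because the difference
or quotient of their sides is a level-one modular function whose behaviour at the cusp forces it to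
be zero or constant. The lower half-plane follows from the symmetry `τ ↦ -τ`. -/

section BurnsideFunction

open Complex Filter Topology Set

open scoped UpperHalfPlane ModularForm MatrixGroups Manifold

/-! ### Level-one modular functions and cusp forms of low weight. -/

section LevelOne

open UpperHalfPlane ModularGroup

theorem levelOne_slash_eq {k : ℤ} {g : ℂ → ℂ}
    (hT : ∀ τ : ℂ, 0 < τ.im → g (τ + 1) = g τ)
    (hS : ∀ τ : ℂ, 0 < τ.im → g (-1 / τ) = τ ^ k * g τ) (γ : SL(2, ℤ)) :
    (fun τ : ℍ => g τ) ∣[k] γ = fun τ : ℍ => g τ := by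
  refine SlashInvariantForm.slash_action_generators_SL2Z ?_ ?_ γ
  · ext τ
    rw [ModularForm.SL_slash_apply, denom_S, modular_S_smul]
    have h := hS τ τ.im_pos
    have h0 : (τ : ℂ) ≠ 0 := ne_zero τ
    have h1 : (-(τ : ℂ))⁻¹ = -1 / τ := by field_simp
    simp only [h1, h]
    rw [mul_comm, ← mul_assoc, ← zpow_add₀ h0]
    simp
  · ext τ
    rw [ModularForm.SL_slash_apply, modular_T_smul]
    have h := hT τ τ.im_pos
    have hden : UpperHalfPlane.denom ModularGroup.T τ = 1 := by
      rw [ModularGroup.denom_apply]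
      simp [ModularGroup.coe_T]
    rw [hden]
    simp [add_comm (1 : ℂ), h]

theorem mdifferentiable_of_differentiableOn {g : ℂ → ℂ}
    (hd : DifferentiableOn ℂ g {τ : ℂ | 0 < τ.im}) : MDiff (fun τ : ℍ => g τ) := by
  rw [mdifferentiable_iff]
  refine hd.congr fun z hz => ?_
  simp [ofComplex_apply_of_im_pos hz]

theorem levelOne_weight_zero_eq_const {g : ℂ → ℂ}
    (hd : DifferentiableOn ℂ g {τ : ℂ | 0 < τ.im})
    (hT : ∀ τ : ℂ, 0 < τ.im → g (τ + 1) = g τ)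
    (hS : ∀ τ : ℂ, 0 < τ.im → g (-1 / τ) = g τ)
    (hb : ∃ C Y : ℝ, ∀ τ : ℂ, Y < τ.im → ‖g τ‖ ≤ C) :
    ∃ c, ∀ τ : ℂ, 0 < τ.im → g τ = c := by
  have hs := levelOne_slash_eq (k := 0) hT (by simpa using hS)
  let F : ModularForm 𝒮ℒ 0 :=
    { toFun := fun τ : ℍ => g τ
      slash_action_eq' := fun _ ⟨γ, hγ⟩ => hγ ▸ hs γ
      holo' := mdifferentiable_of_differentiableOn hd
      bdd_at_cusps' := by
        intro c hc
        rw [Subgroup.IsArithmetic.isCusp_iff_isCusp_SL2Z] at hc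
        rw [OnePoint.isBoundedAt_iff_forall_SL2Z hc]
        intro γ _
        rw [hs γ, isBoundedAtImInfty_iff]
        obtain ⟨C, Y, h⟩ := hb
        exact ⟨C, Y + 1, fun z hz => h z (by simpa using by linarith)⟩ }
  obtain ⟨c, hc⟩ := ModularFormClass.levelOne_weight_zero_const F
  exact ⟨c, fun τ hτ => congrFun hc ⟨τ, hτ⟩⟩

/-- There are no nonzero level-one cusp forms of weight below 12. This reduces a differential
identity to two transformation laws and one limit. -/
theorem levelOne_cusp_eq_zero {k : ℤ} (hk : k < 12) {g : ℂ → ℂ}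
    (hd : DifferentiableOn ℂ g {τ : ℂ | 0 < τ.im})
    (hT : ∀ τ : ℂ, 0 < τ.im → g (τ + 1) = g τ)
    (hS : ∀ τ : ℂ, 0 < τ.im → g (-1 / τ) = τ ^ k * g τ)
    (hb : Tendsto g (comap im atTop) (𝓝 0)) :
    ∀ τ : ℂ, 0 < τ.im → g τ = 0 := by
  have hs := levelOne_slash_eq hT hS
  let F : CuspForm 𝒮ℒ k :=
    { toFun := fun τ : ℍ => g τ
      slash_action_eq' := fun _ ⟨γ, hγ⟩ => hγ ▸ hs γ
      holo' := mdifferentiable_of_differentiableOn hd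
      zero_at_cusps' := by
        intro c hc
        rw [Subgroup.IsArithmetic.isCusp_iff_isCusp_SL2Z] at hc
        rw [OnePoint.isZeroAt_iff_forall_SL2Z hc]
        intro γ _
        rw [hs γ]
        exact hb.comp tendsto_coe_atImInfty }
  have h := rank_zero_iff_forall_zero.mp (CuspForm.rank_eq_zero_of_weight_lt_twelve hk) F
  intro τ hτ
  exact DFunLike.congr_fun h ⟨τ, hτ⟩

end LevelOne

/-! ### Periodic functions near the cusp, through their expansion in `q = exp(πiz)`. -/

section PeriodicAtInfinity

open Function.Periodic

local notation "I∞" => comap im atTop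

theorem eventually_im_gt (Y : ℝ) : ∀ᶠ z in I∞, Y < z.im :=
  (eventually_gt_atTop Y).comap im

theorem hasDerivAt_qParam_two (z : ℂ) :
    HasDerivAt (qParam 2) (qParam 2 z * (2 * Real.pi * I / (2 : ℝ))) z := by
  change HasDerivAt (fun z => exp (2 * Real.pi * I * z / (2 : ℝ)))
    (exp (2 * Real.pi * I * z / (2 : ℝ)) * (2 * Real.pi * I / (2 : ℝ))) z
  have h := ((hasDerivAt_id z).const_mul (2 * Real.pi * I)).div_const ((2 : ℝ) : ℂ)
  rw [mul_one] at h
  exact h.cexp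

/-- Boundedness makes `g = G(q)` with `G` analytic at `0`, and the chain rule contributes a factor
`q → 0`. -/
theorem tendsto_deriv_of_periodic {g : ℂ → ℂ} (hp : Function.Periodic g 2)
    (hd : ∀ᶠ z in I∞, DifferentiableAt ℂ g z) (hb : BoundedAtFilter I∞ g) :
    Tendsto (deriv g) I∞ (𝓝 0) := by
  have hp' : Function.Periodic g ((2 : ℝ) : ℂ) := by simpa using hp
  set G := cuspFunction 2 g
  have hG0 : AnalyticAt ℂ G 0 := by
    rw [analyticAt_iff_eventually_differentiableAt, ← nhdsNE_sup_pure]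
    exact ⟨eventually_differentiableAt_cuspFunction_nhds_ne_zero two_pos hp' hd,
      differentiableAt_cuspFunction_zero two_pos hp' hd hb⟩
  have hq : Tendsto (qParam 2) I∞ (𝓝 0) := (qParam_tendsto two_pos).mono_right nhdsWithin_le_nhds
  have hGq : g = G ∘ qParam 2 := funext fun z => (eq_cuspFunction two_ne_zero hp' z).symm
  have hlim : Tendsto (fun z => deriv G (qParam 2 z) * (qParam 2 z * (2 * Real.pi * I / (2 : ℝ))))
      I∞ (𝓝 (deriv G 0 * (0 * (2 * Real.pi * I / (2 : ℝ))))) :=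
    (hG0.deriv.continuousAt.tendsto.comp hq).mul (hq.mul_const _)
  rw [zero_mul, mul_zero] at hlim
  refine hlim.congr' ?_
  filter_upwards [hq.eventually hG0.eventually_analyticAt] with z hz
  have h1 := hasDerivAt_qParam_two z
  rw [hGq]
  exact (hz.differentiableAt.hasDerivAt.comp z h1).deriv.symm

/-- With `G = qⁿ H` and `H(0) ≠ 0` one gets `g' / g = πi (n + q H' / H)`, which has a limit even if
`g` tends to `0`. Eventual nonvanishing of `g` ensures that the order `n` is finite. -/
theorem bounded_logDeriv_of_periodic {g : ℂ → ℂ} (hp : Function.Periodic g 2)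
    (hd : ∀ᶠ z in I∞, DifferentiableAt ℂ g z) (hb : BoundedAtFilter I∞ g)
    (h0 : ∀ᶠ z in I∞, g z ≠ 0) :
    BoundedAtFilter I∞ (fun z => deriv g z / g z) := by
  have hp' : Function.Periodic g ((2 : ℝ) : ℂ) := by simpa using hp
  set G := cuspFunction 2 g with hG
  have hG0 : AnalyticAt ℂ G 0 := by
    rw [analyticAt_iff_eventually_differentiableAt, ← nhdsNE_sup_pure]
    exact ⟨eventually_differentiableAt_cuspFunction_nhds_ne_zero two_pos hp' hd,
      differentiableAt_cuspFunction_zero two_pos hp' hd hb⟩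
  have hq : Tendsto (qParam 2) I∞ (𝓝 0) := (qParam_tendsto two_pos).mono_right nhdsWithin_le_nhds
  have hGq : g = G ∘ qParam 2 := funext fun z => (eq_cuspFunction two_ne_zero hp' z).symm
  have hGne : ¬ ∀ᶠ q in 𝓝 0, G q = 0 := by
    intro h
    have h2 := (hq.eventually h).and h0
    have : (comap im atTop).NeBot := by
      refine (atTop_neBot (α := ℝ)).comap_of_surj fun y => ⟨y * I, by simp⟩
    obtain ⟨z, hz, hz'⟩ := h2.exists
    exact hz' (by rw [hGq]; exact hz)
  obtain ⟨n, H, hH, hH0, hGH⟩ := hG0.exists_eventuallyEq_pow_smul_nonzero_iff.mpr hGne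
  have hlim : Tendsto (fun z => (n + qParam 2 z * (deriv H (qParam 2 z) / H (qParam 2 z))) *
      (2 * Real.pi * I / (2 : ℝ))) I∞
      (𝓝 ((n + 0 * (deriv H 0 / H 0)) * (2 * Real.pi * I / (2 : ℝ)))) :=
    ((hq.mul ((hH.deriv.continuousAt.tendsto.comp hq).div
      (hH.continuousAt.tendsto.comp hq) hH0)).const_add _).mul_const _
  have hbd : BoundedAtFilter I∞ _ := hlim.isBigO_one ℝ
  refine hbd.congr' ?_ (by simp)
  filter_upwards [hq.eventually hG0.eventually_analyticAt, hq.eventually hH.eventually_analyticAt,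
    hq.eventually (hH.continuousAt.eventually_ne hH0), hq.eventually hGH.eventually_nhds] with
    z hz hHz hHz0 hGHz
  have h1 := hasDerivAt_qParam_two z
  have hqz : qParam 2 z ≠ 0 := qParam_ne_zero z
  have h2 : HasDerivAt G (n * qParam 2 z ^ (n - 1) * H (qParam 2 z) +
      qParam 2 z ^ n * deriv H (qParam 2 z)) (qParam 2 z) := by
    refine HasDerivAt.congr_of_eventuallyEq ?_ hGHz
    simpa using (hasDerivAt_pow n (qParam 2 z)).fun_mul hHz.differentiableAt.hasDerivAt
  have h3 := (h2.comp z h1).deriv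
  rw [← hGq] at h3
  have h4 : g z = qParam 2 z ^ n * H (qParam 2 z) := by
    rw [hGq]; simpa using hGHz.self_of_nhds
  rw [h3, h4]
  rcases n with _ | n
  · field_simp
    simp
  · simp only [Nat.add_sub_cancel]
    field_simp
    ring

end PeriodicAtInfinity

/-! ### Half-period shifts of the Weierstrass function of a fixed lattice. -/

namespace PeriodPair

variable (L : PeriodPair)

theorem eventually_notMem_lattice_nhdsNE : ∀ᶠ z in 𝓝[≠] (0 : ℂ), z ∉ L.lattice := by
  filter_upwards [self_mem_nhdsWithin,
    mem_nhdsWithin_of_mem_nhds (L.compl_lattice_sdiff_singleton_mem_nhds 0)] with z hz hz'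
  intro h
  exact hz' ⟨h, hz⟩

theorem weierstrassP_eq_except_zero (z : ℂ) :
    L.weierstrassP z = L.weierstrassPExcept 0 z + 1 / z ^ 2 := by
  have := L.weierstrassPExcept_add 0 z
  simp at this
  simp [← this]

theorem tendsto_sq_mul_weierstrassP_sub (c : ℂ) :
    Tendsto (fun z => z ^ 2 * (L.weierstrassPExcept 0 z - c) + 1) (𝓝 0) (𝓝 1) := by
  have h : ContinuousAt (fun z => z ^ 2 * (L.weierstrassPExcept 0 z - c) + 1) 0 := by
    have := (L.analyticAt_weierstrassPExcept 0).continuousAt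
    fun_prop
  simpa [ContinuousAt] using h

theorem isPreconnected_compl_lattice : IsPreconnected ((L.lattice : Set ℂ)ᶜ) := by
  have hc : (L.lattice : Set ℂ).Countable := by
    rw [← Set.countable_coe_iff]
    exact L.latticeEquivProd.toEquiv.countable_iff.mpr inferInstance
  exact (hc.isConnected_compl_of_one_lt_rank (by simp)).isPreconnected

/-- The identity theorem would spread the constant over the complement of the lattice, contradicting
the double pole: `z² (℘(z) - c) → 1` at `0`. -/
theorem not_eventually_weierstrassP_eq_const {z₀ : ℂ} (hz₀ : z₀ ∉ L.lattice) (c : ℂ) :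
    ¬ ∀ᶠ z in 𝓝 z₀, L.weierstrassP z = c := by
  intro h
  have heq : EqOn L.weierstrassP (fun _ => c) (L.lattice : Set ℂ)ᶜ :=
    L.analyticOnNhd_weierstrassP.eqOn_of_preconnected_of_eventuallyEq analyticOnNhd_const
      L.isPreconnected_compl_lattice hz₀ h
  have h0 : Tendsto (fun z => z ^ 2 * (L.weierstrassPExcept 0 z - c) + 1) (𝓝[≠] 0) (𝓝 0) := by
    refine tendsto_const_nhds.congr' ?_
    filter_upwards [L.eventually_notMem_lattice_nhdsNE, self_mem_nhdsWithin] with z hz hz0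
    have hz0' : z ≠ 0 := hz0
    have h1 := heq hz
    rw [weierstrassP_eq_except_zero] at h1
    rw [eq_sub_of_add_eq h1]
    field_simp
    ring
  exact zero_ne_one (tendsto_nhds_unique h0
    ((L.tendsto_sq_mul_weierstrassP_sub c).mono_left nhdsWithin_le_nhds))

variable {L}

theorem weierstrassP_sub_eq_add {h : ℂ} (h2 : 2 * h ∈ L.lattice) (z : ℂ) :
    L.weierstrassP (z - h) = L.weierstrassP (z + h) := by
  rw [← L.weierstrassP_sub_coe (z + h) ⟨2 * h, h2⟩]
  congr 1
  simp
  ring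

/-- Since `-h ≡ h` modulo the lattice, the left side is even in `z`; it vanishes at `0`, hence to
order at least two. -/
theorem exists_sq_mul_eq_weierstrassP_sub {h : ℂ} (hh : h ∉ L.lattice) (h2 : 2 * h ∈ L.lattice) :
    ∃ r : ℂ → ℂ, AnalyticAt ℂ r 0 ∧
      ∀ᶠ z in 𝓝 0, L.weierstrassP (z - h) - L.weierstrassP h = z ^ 2 * r z := by
  set q : ℂ → ℂ := fun z => L.weierstrassP (z - h) - L.weierstrassP h with hq
  have hqa : AnalyticAt ℂ q 0 := by
    refine AnalyticAt.sub ?_ analyticAt_const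
    refine AnalyticAt.fun_comp (L.analyticOnNhd_weierstrassP _ ?_) (by fun_prop)
    simpa using hh
  have heven : ∀ z, q (-z) = q z := by
    intro z
    simp only [hq]
    rw [weierstrassP_sub_eq_add h2, weierstrassP_sub_eq_add h2, ← L.weierstrassP_neg (-z + h),
      ← weierstrassP_sub_eq_add h2]
    congr 2
    ring
  have hord : ((2 : ℕ) : ℕ∞) ≤ analyticOrderAt q 0 := by
    rw [natCast_le_analyticOrderAt_iff_iteratedDeriv_eq_zero hqa]
    intro i hi
    interval_cases i
    · simp [hq]
    · have h1 := deriv_comp_neg (f := q) (x := 0)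
      have h3 : (fun x => q (-x)) = q := funext heven
      rw [h3, neg_zero] at h1
      rw [iteratedDeriv_one]
      exact CharZero.eq_neg_self_iff.mp h1
  obtain ⟨r, hr, hqr⟩ := (natCast_le_analyticOrderAt hqa).mp hord
  exact ⟨r, hr, by simpa using hqr⟩

/-- The double pole of each factor meets a double zero of the other, so the product extends to an
entire doubly periodic function, which is constant by Liouville. -/
theorem exists_weierstrassP_mul_eq_const {h : ℂ} (hh : h ∉ L.lattice) (h2 : 2 * h ∈ L.lattice) :
    ∃ C : ℂ, C ≠ 0 ∧ ∀ z, z ∉ L.lattice → z - h ∉ L.lattice →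
      (L.weierstrassP z - L.weierstrassP h) * (L.weierstrassP (z - h) - L.weierstrassP h) = C := by
  classical
  obtain ⟨r, hr, hqr⟩ := exists_sq_mul_eq_weierstrassP_sub hh h2
  -- The value `r 0` fills the removable singularities. Periodicity and the symmetry `z ↦ z - h`
  -- reduce all of them to the one at `0`.
  set F : ℂ → ℂ := fun z => if z ∈ L.lattice ∨ z - h ∈ L.lattice then r 0 else
    (L.weierstrassP z - L.weierstrassP h) * (L.weierstrassP (z - h) - L.weierstrassP h) with hF
  have hper : ∀ z, ∀ w ∈ L.lattice, F (z + w) = F z := by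
    intro z w hw
    have h1 : z + w ∈ L.lattice ↔ z ∈ L.lattice := add_mem_cancel_right hw
    have h3 : z + w - h = z - h + w := by ring
    have h4 : z - h + w ∈ L.lattice ↔ z - h ∈ L.lattice := add_mem_cancel_right hw
    have h5 := L.weierstrassP_add_coe z ⟨w, hw⟩
    have h6 := L.weierstrassP_add_coe (z - h) ⟨w, hw⟩
    simp only at h5 h6
    simp only [hF, h1, h3, h4, h5, h6]
  have hsym : ∀ z, F (z - h) = F z := by
    intro z
    have h1 : z - h - h = z + -(2 * h) := by ring
    have h4 : z + -(2 * h) ∈ L.lattice ↔ z ∈ L.lattice := add_mem_cancel_right (neg_mem h2)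
    have h5 := L.weierstrassP_add_coe z ⟨-(2 * h), neg_mem h2⟩
    simp only at h5
    simp only [hF, h1, h4, h5]
    by_cases ha : z ∈ L.lattice <;> by_cases hb : z - h ∈ L.lattice <;> simp [ha, hb, mul_comm]
  have hnear : F =ᶠ[𝓝 0] fun z =>
      (z ^ 2 * (L.weierstrassPExcept 0 z - L.weierstrassP h) + 1) * r z := by
    have hne : ∀ᶠ z in 𝓝 (0 : ℂ), z - h ∉ L.lattice := by
      have hc : ContinuousAt (fun z : ℂ => z - h) 0 := by fun_prop
      refine hc.eventually (L.isClosed_lattice.isOpen_compl.mem_nhds ?_)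
      simpa using hh
    have hne0 := eventually_nhdsWithin_iff.mp L.eventually_notMem_lattice_nhdsNE
    filter_upwards [hne, hne0, hqr] with z hz1 hz2 hz3
    by_cases hz : z = 0
    · simp [hF, hz]
    · have hz4 := hz2 hz
      simp only [hF, hz1, hz4, or_self, if_false, hz3]
      rw [weierstrassP_eq_except_zero]
      field_simp
      ring
  have hd0 : DifferentiableAt ℂ F 0 := by
    refine DifferentiableAt.congr_of_eventuallyEq ?_ hnear
    have := (L.analyticAt_weierstrassPExcept 0).differentiableAt
    have := hr.differentiableAt
    fun_prop
  have hdL : ∀ z ∈ L.lattice, DifferentiableAt ℂ F z := by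
    intro z hz
    have h1 : F = fun w => F (w - z) := by
      funext w
      rw [← hper (w - z) z hz, sub_add_cancel]
    rw [h1]
    have h3 : DifferentiableAt ℂ F (z - z) := by simpa using hd0
    exact DifferentiableAt.comp (f := fun w => w - z) z h3 (by fun_prop)
  have hd : Differentiable ℂ F := by
    intro z
    by_cases hz : z ∈ L.lattice
    · exact hdL z hz
    by_cases hzh : z - h ∈ L.lattice
    · have h1 : F = fun w => F (w - h) := funext fun w => (hsym w).symm
      rw [h1]
      exact DifferentiableAt.comp (f := fun w => w - h) z (hdL _ hzh) (by fun_prop)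
    have hc : ContinuousAt (fun z : ℂ => z - h) z := by fun_prop
    have heq : F =ᶠ[𝓝 z] fun z =>
        (L.weierstrassP z - L.weierstrassP h) * (L.weierstrassP (z - h) - L.weierstrassP h) := by
      filter_upwards [L.isClosed_lattice.isOpen_compl.mem_nhds hz,
        hc.eventually (L.isClosed_lattice.isOpen_compl.mem_nhds hzh)] with w hw hw'
      have hw1 : w ∉ L.lattice := hw
      have hw2 : w - h ∉ L.lattice := hw'
      simp only [hF, hw1, hw2, or_self, if_false]
    refine DifferentiableAt.congr_of_eventuallyEq ?_ heq
    have h1 : DifferentiableAt ℂ L.weierstrassP z :=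
      (L.analyticOnNhd_weierstrassP z hz).differentiableAt
    have h3 : DifferentiableAt ℂ L.weierstrassP (z - h) :=
      (L.analyticOnNhd_weierstrassP _ hzh).differentiableAt
    have h4 : DifferentiableAt ℂ (fun z => L.weierstrassP (z - h)) z :=
      DifferentiableAt.comp (f := fun w => w - h) z h3 (by fun_prop)
    fun_prop
  have hconst : ∀ z, F z = r 0 := by
    intro z
    have h1 := hd.apply_eq_apply_of_bounded
      (IsZLattice.isCompact_range_of_periodic L.lattice F hd.continuous hper).isBounded z 0
    rw [h1]
    simp [hF]
  refine ⟨r 0, ?_, fun z hz hzh => ?_⟩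
  -- If the constant were `0`, then near `0` the second factor would vanish, since `z²` times the
  -- first tends to `1`; so `℘` would be constant near `-h`.
  · intro hr0
    refine L.not_eventually_weierstrassP_eq_const (z₀ := -h) (by simpa using hh)
      (L.weierstrassP h) ?_
    have hev : ∀ᶠ z in 𝓝 (0 : ℂ), L.weierstrassP (z - h) = L.weierstrassP h := by
      filter_upwards [hnear, hqr, (L.tendsto_sq_mul_weierstrassP_sub
        (L.weierstrassP h)).eventually_ne one_ne_zero] with z hz1 hz2 hz3
      rw [hconst, hr0] at hz1
      have hrz : r z = 0 := by
        rcases mul_eq_zero.mp hz1.symm with h | h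
        · exact absurd h hz3
        · exact h
      rw [hrz, mul_zero] at hz2
      exact sub_eq_zero.mp hz2
    have hc : Tendsto (fun z : ℂ => z + h) (𝓝 (-h)) (𝓝 0) := by
      have : ContinuousAt (fun z : ℂ => z + h) (-h) := by fun_prop
      simpa [ContinuousAt] using this
    filter_upwards [hc.eventually hev] with z hz
    simpa using hz
  · have h1 := hconst z
    simpa only [hF, hz, hzh, or_self, if_false] using h1

theorem derivWeierstrassP_half {h : ℂ} (h2 : 2 * h ∈ L.lattice) : L.derivWeierstrassP h = 0 := by
  have h1 := L.derivWeierstrassP_sub_coe h ⟨2 * h, h2⟩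
  have h3 : h - 2 * h = -h := by ring
  simp only [h3, derivWeierstrassP_neg] at h1
  exact (CharZero.eq_neg_self_iff.mp h1.symm)

end PeriodPair

/-! ### Dependence of `℘` on the lattice: change of basis and scaling. -/

section WeierstrassFamily

theorem wp_of_im_eq_zero {τ : ℂ} (hτ : τ.im = 0) (z : ℂ) : wp z 2 (2 * τ) = 0 := by
  rw [wp, dif_neg]
  intro h
  have h1 := (LinearIndependent.pair_iff.mp h τ.re (-1) ?_).2
  · norm_num at h1
  · apply Complex.ext <;> simp [hτ]
    ring

/-- Indexed by row vectors, the lattice sum turns a change of basis into a reindexing and matches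
the bounds for Eisenstein series. At `x = 0` the convention `1 / 0 = 0` leaves the correct term `1 /
z²`. -/
theorem hasSum_wp {τ : ℂ} (hτ : τ.im ≠ 0) (z : ℂ) :
    HasSum (fun x : Fin 2 → ℤ => 1 / (z - 4 * (x 0 * τ + x 1)) ^ 2 - 1 / (4 * (x 0 * τ + x 1)) ^ 2)
      (wp z 2 (2 * τ)) := by
  rw [wp_eq_weierstrassP hτ]
  set L := PeriodPair.mk (2 * 2) (2 * (2 * τ)) (linearIndependent_periods hτ)
  have h := L.hasSum_weierstrassP z
  rw [← L.latticeEquivProd.symm.toEquiv.hasSum_iff,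
    ← ((finTwoArrowEquiv ℤ).trans (Equiv.prodComm ℤ ℤ)).hasSum_iff] at h
  refine h.congr_fun fun x => ?_
  have h2 : ((L.latticeEquivProd.symm (x 1, x 0) : L.lattice) : ℂ) = 4 * (x 0 * τ + x 1) := by
    rw [L.latticeEquiv_symm_apply]
    simp only [L]
    ring
  change _ = 1 / (z - ((L.latticeEquivProd.symm (x 1, x 0) : L.lattice) : ℂ)) ^ 2 -
    1 / ((L.latticeEquivProd.symm (x 1, x 0) : L.lattice) : ℂ) ^ 2
  rw [h2]

theorem wp_neg {τ : ℂ} (z : ℂ) : wp (-z) 2 (2 * τ) = wp z 2 (2 * τ) := by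
  by_cases hτ : τ.im = 0
  · simp [wp_of_im_eq_zero hτ]
  · simp only [wp_eq_weierstrassP hτ, PeriodPair.weierstrassP_neg]

theorem wp_add_period {τ : ℂ} (z : ℂ) (m n : ℤ) :
    wp (z + (m * 4 + n * (4 * τ))) 2 (2 * τ) = wp z 2 (2 * τ) := by
  by_cases hτ : τ.im = 0
  · simp [wp_of_im_eq_zero hτ]
  · simp only [wp_eq_weierstrassP hτ]
    set L := PeriodPair.mk (2 * 2) (2 * (2 * τ)) (linearIndependent_periods hτ)
    have hm : (m * 4 + n * (4 * τ) : ℂ) ∈ L.lattice := by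
      rw [PeriodPair.mem_lattice]
      exact ⟨m, n, by simp only [L]; ring⟩
    exact L.weierstrassP_add_coe z ⟨_, hm⟩

/-- Integer row vectors of length two, multiplied by the matrix `!![a, b; c, d]`. -/
def intVecEquiv (a b c d : ℤ) (h : a * d - b * c = 1) : (Fin 2 → ℤ) ≃ (Fin 2 → ℤ) where
  toFun x := ![x 0 * a + x 1 * c, x 0 * b + x 1 * d]
  invFun x := ![x 0 * d - x 1 * c, x 1 * a - x 0 * b]
  left_inv x := by
    ext i
    fin_cases i
    · simp; linear_combination (x 0) * h
    · simp; linear_combination (x 1) * h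
  right_inv x := by
    ext i
    fin_cases i
    · simp; linear_combination (x 0) * h
    · simp; linear_combination (x 1) * h

theorem wp_add_one (z τ : ℂ) : wp z 2 (2 * (τ + 1)) = wp z 2 (2 * τ) := by
  by_cases hτ : τ.im = 0
  · rw [wp_of_im_eq_zero hτ, wp_of_im_eq_zero (by simpa using hτ)]
  · have h1 := hasSum_wp (τ := τ + 1) (by simpa using hτ) z
    have h2 := hasSum_wp hτ z
    rw [← (intVecEquiv 1 1 0 1 (by norm_num)).hasSum_iff] at h2
    refine h1.unique (h2.congr_fun fun x => ?_)
    simp only [intVecEquiv, Function.comp_apply, Equiv.coe_fn_mk, Matrix.cons_val_zero,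
      Matrix.cons_val_one]
    push_cast
    ring_nf

theorem wp_neg_period (z τ : ℂ) : wp z 2 (2 * (-τ)) = wp z 2 (2 * τ) := by
  by_cases hτ : τ.im = 0
  · rw [wp_of_im_eq_zero hτ, wp_of_im_eq_zero (by simpa using hτ)]
  · have h1 := hasSum_wp (τ := -τ) (by simpa using hτ) z
    have h2 := hasSum_wp hτ (-z)
    rw [wp_neg, ← (intVecEquiv 1 0 0 1 (by norm_num)).hasSum_iff,
      ← (Equiv.piCongrRight fun i : Fin 2 => if i = 0 then Equiv.refl ℤ else Equiv.neg ℤ).hasSum_iff] at h2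
    refine h1.unique (h2.congr_fun fun x => ?_)
    simp [intVecEquiv, Function.comp_apply]
    ring_nf

theorem wp_inv {τ : ℂ} (hτ : τ.im ≠ 0) (z : ℂ) :
    wp (z / τ) 2 (2 * (-1 / τ)) = τ ^ 2 * wp z 2 (2 * τ) := by
  have h0 : τ ≠ 0 := by rintro rfl; simp at hτ
  have hτ' : (-1 / τ).im ≠ 0 := by
    rw [neg_div, one_div, neg_im, inv_im]
    have := normSq_pos.mpr h0
    simp [hτ, h0]
  have h1 := hasSum_wp hτ' (z / τ)
  have h2 := (hasSum_wp hτ z).mul_left (τ ^ 2)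
  rw [← (intVecEquiv 0 (-1) 1 0 (by norm_num)).hasSum_iff] at h2
  refine h1.unique (h2.congr_fun fun x => ?_)
  simp only [intVecEquiv, Function.comp_apply, Equiv.coe_fn_mk, Matrix.cons_val_zero,
    Matrix.cons_val_one]
  push_cast
  have e1 : z / τ - 4 * (x 0 * (-1 / τ) + x 1) =
      (z - 4 * ((x 0 * 0 + x 1 * 1) * τ + (x 0 * -1 + x 1 * 0))) / τ := by
    field_simp
    ring
  have e2 : 4 * (x 0 * (-1 / τ) + x 1) =
      4 * ((x 0 * 0 + x 1 * 1) * τ + (x 0 * -1 + x 1 * 0)) / τ := by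
    field_simp
    ring
  rw [e1, e2, div_pow, div_pow, one_div_div, one_div_div]
  ring

end WeierstrassFamily

/-! ### Half-period values and their modular transformations. -/

section HalfPeriods

/-- The values of the Weierstrass function of the lattice `4ℤ + 4τℤ` at its half-periods. -/
noncomputable def halfPeriodValue (i : Fin 3) (τ : ℂ) : ℂ :=
  wp (![2, 2 + 2 * τ, 2 * τ] i) 2 (2 * τ)

local notation "e" => halfPeriodValue

theorem halfPeriodValue_zero (τ : ℂ) : e 0 τ = wp 2 2 (2 * τ) := rfl
theorem halfPeriodValue_one (τ : ℂ) : e 1 τ = wp (2 + 2 * τ) 2 (2 * τ) := rfl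
theorem halfPeriodValue_two (τ : ℂ) : e 2 τ = wp (2 * τ) 2 (2 * τ) := rfl

/-- The substitutions `τ + 1` and `-1/τ` change the lattice by a basis change and a scaling, so they
permute its half-periods. Expressions symmetric under these permutations are therefore of level one.
-/
theorem halfPeriodValue_add_one (i : Fin 3) (τ : ℂ) :
    e i (τ + 1) = e (Equiv.swap 1 2 i) τ := by
  fin_cases i
  · exact wp_add_one _ _
  · change wp (2 + 2 * (τ + 1)) 2 (2 * (τ + 1)) = wp (2 * τ) 2 (2 * τ)
    rw [wp_add_one, ← wp_add_period (2 * τ) 1 0]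
    congr 1
    push_cast
    ring
  · change wp (2 * (τ + 1)) 2 (2 * (τ + 1)) = wp (2 + 2 * τ) 2 (2 * τ)
    rw [wp_add_one]
    congr 1
    ring

theorem halfPeriodValue_neg (i : Fin 3) (τ : ℂ) : e i (-τ) = e i τ := by
  fin_cases i
  · exact wp_neg_period _ _
  · change wp (2 + 2 * (-τ)) 2 (2 * (-τ)) = wp (2 + 2 * τ) 2 (2 * τ)
    rw [wp_neg_period, ← wp_add_period _ 0 1]
    congr 1
    push_cast
    ring
  · change wp (2 * (-τ)) 2 (2 * (-τ)) = wp (2 * τ) 2 (2 * τ)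
    rw [wp_neg_period, mul_neg, wp_neg]

theorem halfPeriodValue_inv (i : Fin 3) {τ : ℂ} (hτ : τ.im ≠ 0) :
    e i (-1 / τ) = τ ^ 2 * e (Equiv.swap 0 2 i) τ := by
  have h0 : τ ≠ 0 := by rintro rfl; simp at hτ
  fin_cases i
  · change wp 2 2 (2 * (-1 / τ)) = τ ^ 2 * wp (2 * τ) 2 (2 * τ)
    rw [← wp_inv hτ, mul_div_cancel_right₀ _ h0]
  · change wp (2 + 2 * (-1 / τ)) 2 (2 * (-1 / τ)) = τ ^ 2 * wp (2 + 2 * τ) 2 (2 * τ)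
    rw [← wp_inv hτ, ← wp_add_period (2 + 2 * (-1 / τ)) 0 (-1)]
    congr 1
    field_simp
    push_cast
    ring
  · change wp (2 * (-1 / τ)) 2 (2 * (-1 / τ)) = τ ^ 2 * wp 2 2 (2 * τ)
    rw [← wp_inv hτ, ← wp_neg]
    congr 1
    ring

end HalfPeriods

/-! ### Holomorphy in `τ` and limits at the cusp. -/

section Analytic

open UpperHalfPlane (verticalStrip)

local notation "e" => halfPeriodValue
local notation "I∞" => comap im atTop

theorem tendsto_norm_int_pair_cofinite : Tendsto (fun x : Fin 2 → ℤ => ‖x‖) cofinite atTop := by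
  simpa using tendsto_norm_comp_cofinite_atTop_of_isClosedEmbedding
    (Topology.IsClosedEmbedding.id (X := Fin 2 → ℤ))

theorem norm_int_combination_ge {A B : ℝ} (hB : 0 < B) {τ : ℂ} (hA : |τ.re| ≤ A) (hτ : B ≤ τ.im)
    (x : Fin 2 → ℤ) :
    EisensteinSeries.r ⟨⟨A, B⟩, hB⟩ * ‖x‖ ≤ ‖(x 0 * τ + x 1 : ℂ)‖ := by
  by_cases hx : x = 0
  · simp [hx]
  have h1 := EisensteinSeries.r_mul_max_le ⟨τ, hB.trans_le hτ⟩ hx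
  refine le_trans (mul_le_mul_of_nonneg_right ?_ (norm_nonneg _)) h1
  exact EisensteinSeries.r_lower_bound_on_verticalStrip _ hB ⟨hA, hτ⟩

/-- The lattice sum at `α + βτ` converges locally uniformly in `τ`, its terms being `O(‖x‖⁻³)`; the
hypothesis keeps the argument off the lattice for every `τ` in the half-plane. -/
theorem differentiableOn_wp_period (α β : ℝ) (h : ¬ ∃ m n : ℤ, α = 4 * m ∧ β = 4 * n) :
    DifferentiableOn ℂ (fun τ : ℂ => wp (α + β * τ) 2 (2 * τ)) {τ : ℂ | 0 < τ.im} := by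
  intro τ₀ hτ₀
  refine DifferentiableAt.differentiableWithinAt ?_
  set A := |τ₀.re| + 1
  set B := τ₀.im / 2
  set R := ‖τ₀‖ + 1
  have hB : 0 < B := half_pos hτ₀
  set s : Set ℂ := {τ | |τ.re| < A ∧ B < τ.im ∧ ‖τ‖ < R} with hs
  have hso : IsOpen s := by
    have h1 : IsOpen {τ : ℂ | |τ.re| < A} := isOpen_lt (by fun_prop) (by fun_prop)
    have h2 : IsOpen {τ : ℂ | B < τ.im} := isOpen_lt (by fun_prop) (by fun_prop)
    have h3 : IsOpen {τ : ℂ | ‖τ‖ < R} := isOpen_lt (by fun_prop) (by fun_prop)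
    exact h1.inter (h2.inter h3)
  have hmem : τ₀ ∈ s := ⟨lt_add_one _, half_lt_self hτ₀, lt_add_one _⟩
  set r := EisensteinSeries.r ⟨⟨A, B⟩, hB⟩
  have hr : 0 < r := EisensteinSeries.r_pos _
  set R₀ := |α| + |β| * R + 1
  have hR₀ : 0 < R₀ := by positivity
  set F : (Fin 2 → ℤ) → ℂ → ℂ := fun x τ =>
    1 / (α + β * τ - 4 * (x 0 * τ + x 1)) ^ 2 - 1 / (4 * (x 0 * τ + x 1)) ^ 2 with hF
  have hbound : ∀ᶠ x in cofinite, ∀ τ ∈ s,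
      ‖F x τ‖ ≤ 10 * R₀ * (r * 4) ^ (-3 : ℝ) * ‖x‖ ^ (-3 : ℝ) := by
    filter_upwards [tendsto_norm_int_pair_cofinite.eventually_ge_atTop (2 * R₀ / (4 * r)),
      tendsto_norm_int_pair_cofinite.eventually_gt_atTop 0] with x hx hx0 τ hτ
    have h1 := norm_int_combination_ge hB hτ.1.le hτ.2.1.le x
    have h4 : r * 4 * ‖x‖ ≤ ‖(4 * (x 0 * τ + x 1) : ℂ)‖ := by
      rw [norm_mul]
      simp only [Complex.norm_ofNat]
      linarith
    have hz : ‖(α + β * τ : ℂ)‖ < R₀ := by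
      calc ‖(α + β * τ : ℂ)‖ ≤ |α| + |β| * ‖τ‖ := by
            refine (norm_add_le _ _).trans (by simp)
        _ ≤ |α| + |β| * R := by gcongr; exact hτ.2.2.le
        _ < R₀ := lt_add_one _
    rw [div_le_iff₀ (by positivity)] at hx
    refine (PeriodPair.weierstrassP_bound R₀ hR₀ _ hz _ (by linarith)).trans ?_
    rw [mul_assoc (10 * R₀), ← Real.mul_rpow (by positivity) (by positivity)]
    gcongr 10 * R₀ * ?_
    exact Real.rpow_le_rpow_of_nonpos (by positivity) h4 (by norm_num)
  have hunif := tendstoUniformlyOn_tsum_of_cofinite_eventually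
    (f := F) (s := s) ((EisensteinSeries.summable_one_div_norm_rpow
      (k := 3) (by norm_num)).mul_left (10 * R₀ * (r * 4) ^ (-3 : ℝ))) hbound
  have hdiff : DifferentiableOn ℂ (fun τ => ∑' x, F x τ) s := by
    refine hunif.tendstoLocallyUniformlyOn.differentiableOn (.of_forall fun t => ?_) hso
    refine DifferentiableOn.fun_sum fun x _ => ?_
    intro τ hτ
    have him : 0 < τ.im := hB.trans hτ.2.1
    have hne1 : (α + β * τ - 4 * (x 0 * τ + x 1) : ℂ) ≠ 0 := by
      intro h0
      have h1 := congrArg Complex.im h0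
      have h2 := congrArg Complex.re h0
      simp at h1 h2
      have h3 : (β - 4 * x 0) * τ.im = 0 := by linarith
      rcases mul_eq_zero.mp h3 with h4 | h4
      · refine h ⟨x 1, x 0, ?_, by linarith⟩
        have h5 : β = 4 * x 0 := by linarith
        rw [h5] at h2
        linarith
      · exact him.ne' h4
    have hd1 : DifferentiableAt ℂ
        (fun τ : ℂ => 1 / (α + β * τ - 4 * (x 0 * τ + x 1) : ℂ) ^ 2) τ := by
      fun_prop (disch := exact pow_ne_zero 2 hne1)
    have hd2 : DifferentiableAt ℂ (fun τ : ℂ => 1 / (4 * (x 0 * τ + x 1) : ℂ) ^ 2) τ := by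
      -- At `x = 0` this summand is the constant `1 / 0 = 0`.
      by_cases hx : x = 0
      · simp [hx]
      · have h1 := norm_int_combination_ge hB hτ.1.le hτ.2.1.le x
        have hne2 : (4 * (x 0 * τ + x 1) : ℂ) ≠ 0 := by
          refine mul_ne_zero (by norm_num) (norm_pos_iff.mp (lt_of_lt_of_le ?_ h1))
          have := norm_pos_iff.mpr hx
          positivity
        fun_prop (disch := exact pow_ne_zero 2 hne2)
    exact (hd1.sub hd2).differentiableWithinAt
  refine (hdiff.differentiableAt (hso.mem_nhds hmem)).congr_of_eventuallyEq ?_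
  filter_upwards [hso.mem_nhds hmem] with τ hτ
  exact (hasSum_wp (hB.trans hτ.2.1).ne' _).tsum_eq.symm

theorem differentiableOn_halfPeriodValue (i : Fin 3) :
    DifferentiableOn ℂ (e i) {τ : ℂ | 0 < τ.im} := by
  have key (n : ℤ) (hn : (2 : ℝ) = 4 * n) : False := by
    have h1 : (2 : ℤ) = 4 * n := by exact_mod_cast hn
    omega
  fin_cases i
  · have := differentiableOn_wp_period 2 0 (by rintro ⟨m, n, h, -⟩; exact key m h)
    change DifferentiableOn ℂ (fun τ => wp 2 2 (2 * τ)) _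
    simpa using this
  · have := differentiableOn_wp_period 2 2 (by rintro ⟨m, n, h, -⟩; exact key m h)
    change DifferentiableOn ℂ (fun τ => wp (2 + 2 * τ) 2 (2 * τ)) _
    simpa using this
  · have := differentiableOn_wp_period 0 2 (by rintro ⟨m, n, -, h⟩; exact key n h)
    change DifferentiableOn ℂ (fun τ => wp (2 * τ) 2 (2 * τ)) _
    simpa using this

theorem norm_inv_sq_sub_inv_sq_le {a b : ℂ} {M : ℝ} (hM : 0 < M) (ha : M ≤ ‖a‖) (hb : M ≤ ‖b‖)
    (hab : ‖a - b‖ ≤ 2) : ‖1 / a ^ 2 - 1 / b ^ 2‖ ≤ 4 / M ^ 3 := by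
  have ha0 : 0 < ‖a‖ := hM.trans_le ha
  have hb0 : 0 < ‖b‖ := hM.trans_le hb
  have ha1 : a ≠ 0 := norm_pos_iff.mp ha0
  have hb1 : b ≠ 0 := norm_pos_iff.mp hb0
  have h1 : 1 / a ^ 2 - 1 / b ^ 2 = (b - a) * (1 / (a * b ^ 2) + 1 / (a ^ 2 * b)) := by
    field_simp
    ring
  rw [h1, norm_mul, norm_sub_rev]
  have h2 : ‖1 / (a * b ^ 2)‖ ≤ 1 / M ^ 3 := by
    rw [norm_div, norm_one, norm_mul, norm_pow, pow_succ' M 2]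
    gcongr
  have h3 : ‖1 / (a ^ 2 * b)‖ ≤ 1 / M ^ 3 := by
    rw [norm_div, norm_one, norm_mul, norm_pow, pow_succ M 2]
    gcongr
  calc ‖a - b‖ * ‖1 / (a * b ^ 2) + 1 / (a ^ 2 * b)‖ ≤ 2 * (1 / M ^ 3 + 1 / M ^ 3) := by
        gcongr
        exact (norm_add_le _ _).trans (add_le_add h2 h3)
    _ = 4 / M ^ 3 := by ring

theorem tendsto_one_div_sq_linear (p : ℂ) {n : ℤ} (hn : n ≠ 0) :
    Tendsto (fun τ : ℂ => 1 / (p + n * τ) ^ 2) I∞ (𝓝 0) := by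
  have h1 : Tendsto (fun τ : ℂ => ‖p + n * τ‖) I∞ atTop := by
    have h2 : Tendsto (fun τ : ℂ => |(n : ℝ)| * τ.im - ‖p‖) I∞ atTop := by
      refine tendsto_atTop_add_const_right _ _ ?_
      exact tendsto_comap.const_mul_atTop (by positivity)
    refine tendsto_atTop_mono' _ ?_ h2
    filter_upwards [eventually_im_gt 0] with τ hτ
    have h3 : |(n : ℝ)| * τ.im ≤ ‖(n * τ : ℂ)‖ := by
      rw [norm_mul, Complex.norm_intCast]
      gcongr
      exact (le_abs_self _).trans (Complex.abs_im_le_norm τ)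
    have h4 := norm_sub_norm_le (n * τ : ℂ) (-p)
    rw [norm_neg, sub_neg_eq_add, add_comm (n * τ : ℂ)] at h4
    linarith
  have h5 := (tendsto_inv_atTop_zero.comp ((tendsto_pow_atTop two_ne_zero).comp h1))
  rw [tendsto_zero_iff_norm_tendsto_zero]
  refine h5.congr fun τ => ?_
  simp

/-- The lower bounds for `‖x 0 * τ + x 1‖` are uniform only in vertical strips; periodicity makes
one strip sufficient. -/
theorem tendsto_of_periodic_of_strip {g : ℂ → ℂ} {a : ℂ} (hp : Function.Periodic g 2)
    (hg : Tendsto g (I∞ ⊓ 𝓟 {τ | |τ.re| ≤ 1}) (𝓝 a)) : Tendsto g I∞ (𝓝 a) := by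
  have h1 : Tendsto (fun τ : ℂ => τ - round (τ.re / 2) * 2) I∞ (I∞ ⊓ 𝓟 {τ | |τ.re| ≤ 1}) := by
    refine tendsto_inf.mpr ⟨?_, ?_⟩
    · rw [tendsto_comap_iff]
      refine tendsto_comap.congr fun τ => ?_
      simp
    · refine tendsto_principal.mpr (.of_forall fun τ => ?_)
      have h2 := abs_sub_round (τ.re / 2)
      simp only [mem_ofPred_eq, sub_re, mul_re, intCast_re, re_ofNat, intCast_im, im_ofNat, mul_zero,
        sub_zero]
      rw [abs_le] at h2 ⊢
      constructor <;> linarith [h2.1, h2.2]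
  refine (hg.comp h1).congr fun τ => ?_
  exact hp.sub_int_mul_eq _

instance neBot_comap_im_inf : (I∞ ⊓ 𝓟 {τ | |τ.re| ≤ 1}).NeBot := by
  rw [inf_principal_neBot_iff]
  intro U hU
  obtain ⟨V, hV, hVU⟩ := mem_comap.mp hU
  obtain ⟨y, hy⟩ := (Filter.nonempty_of_mem hV)
  exact ⟨y * I, hVU (by simpa using hy), by simp⟩

theorem eventually_mem_strip : ∀ᶠ τ in I∞ ⊓ 𝓟 {τ | |τ.re| ≤ 1}, |τ.re| ≤ 1 ∧ 1 ≤ τ.im := by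
  refine eventually_inf_principal.mpr ?_
  filter_upwards [eventually_im_gt 1] with τ h1 h2
  exact ⟨h2, h1.le⟩

theorem summable_const_mul_inv_norm_cube {v : (Fin 2 → ℤ) → (Fin 2 → ℤ)}
    (hv : Function.Injective v) (C : ℝ) : Summable fun x => C / ‖v x‖ ^ 3 := by
  have h := ((EisensteinSeries.summable_one_div_norm_rpow (k := 3) (by norm_num)).comp_injective
    hv).mul_left C
  refine h.congr fun x => ?_
  rw [Function.comp_apply, Real.rpow_neg (norm_nonneg _), div_eq_mul_inv]
  norm_cast

theorem one_le_norm_int_pair {x : Fin 2 → ℤ} (hx : x ≠ 0) : 1 ≤ ‖x‖ := by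
  obtain ⟨i, hi⟩ := Function.ne_iff.mp hx
  refine le_trans ?_ (norm_le_pi_norm x i)
  rw [Int.norm_eq_abs]
  exact_mod_cast Int.one_le_abs hi

theorem periodic_halfPeriodValue (i : Fin 3) : Function.Periodic (e i) 2 := by
  intro τ
  rw [← one_add_one_eq_two, ← add_assoc, halfPeriodValue_add_one, halfPeriodValue_add_one]
  simp

/-- In both series the coefficient of `τ` in each term, `2 - 4 x₀`, is never zero, so every term
dies at the cusp; dominated convergence applies to the difference. -/
theorem tendsto_halfPeriodValue_one_sub_two :
    Tendsto (fun τ => e 1 τ - e 2 τ) I∞ (𝓝 0) := by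
  refine tendsto_of_periodic_of_strip
    (fun τ => by simp only [(periodic_halfPeriodValue _) τ]) ?_
  set r := EisensteinSeries.r ⟨⟨1, 1⟩, one_pos⟩
  have hr : 0 < r := EisensteinSeries.r_pos _
  set v : (Fin 2 → ℤ) → (Fin 2 → ℤ) := fun x => ![1 - 2 * x 0, 1 - 2 * x 1] with hv
  have hvi : Function.Injective v := by
    intro x y hxy
    have h0 := congrFun hxy 0
    have h1 := congrFun hxy 1
    simp [hv] at h0 h1
    ext i
    fin_cases i
    · exact h0
    · exact h1
  have hlim := tendsto_tsum_of_dominated_convergence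
    (f := fun τ (x : Fin 2 → ℤ) => 1 / (2 + 2 * τ - 4 * (x 0 * τ + x 1)) ^ 2 -
      1 / (2 * τ - 4 * (x 0 * τ + x 1)) ^ 2) (g := fun _ => (0 : ℂ))
    (𝓕 := I∞ ⊓ 𝓟 {τ | |τ.re| ≤ 1})
    (summable_const_mul_inv_norm_cube hvi (4 / r ^ 3)) ?_ ?_
  · rw [tsum_zero] at hlim
    refine hlim.congr' ?_
    filter_upwards [eventually_mem_strip] with τ hτ
    have him : τ.im ≠ 0 := by linarith [hτ.2]
    have h1 := (hasSum_wp him (2 + 2 * τ)).sub (hasSum_wp him (2 * τ))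
    rw [halfPeriodValue_one, halfPeriodValue_two, ← h1.tsum_eq]
    congr 1
    ext x
    ring
  · intro x
    refine Tendsto.mono_left ?_ inf_le_left
    have hn : (2 - 4 * x 0 : ℤ) ≠ 0 := by omega
    have h1 := (tendsto_one_div_sq_linear (2 - 4 * x 1) hn).sub
      (tendsto_one_div_sq_linear (- 4 * x 1) hn)
    rw [sub_zero] at h1
    refine h1.congr fun τ => ?_
    push_cast
    ring_nf
  · filter_upwards [eventually_mem_strip] with τ hτ x
    -- The vectors `v x` and `w` are half the coordinates of the two squared denominators. They have
    -- comparable norms, so both denominators are bounded below by `r * ‖v x‖`.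
    set w : Fin 2 → ℤ := ![1 - 2 * x 0, - 2 * x 1] with hw
    have hw1 : 1 ≤ ‖w‖ := one_le_norm_int_pair fun h => by
      have := congrFun h 0
      simp [hw] at this
      omega
    have hvw : ‖v x‖ ≤ 2 * ‖w‖ := by
      have h1 : v x = w + ![0, 1] := by
        ext i; fin_cases i <;> simp [hv, hw]
        ring
      have h2 : ‖(![0, 1] : Fin 2 → ℤ)‖ ≤ 1 := by
        refine (pi_norm_le_iff_of_nonneg zero_le_one).mpr fun i => ?_
        fin_cases i <;> simp
      rw [h1]
      linarith [norm_add_le w ![0, 1]]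
    have hv1 : 1 ≤ ‖v x‖ := one_le_norm_int_pair fun h => by
      have := congrFun h 0
      simp [hv] at this
      omega
    have ha := norm_int_combination_ge one_pos hτ.1 hτ.2 (v x)
    have hb := norm_int_combination_ge one_pos hτ.1 hτ.2 w
    have ea : (2 + 2 * τ - 4 * (x 0 * τ + x 1) : ℂ) = 2 * (v x 0 * τ + v x 1) := by
      simp [hv]; ring
    have eb : (2 * τ - 4 * (x 0 * τ + x 1) : ℂ) = 2 * (w 0 * τ + w 1) := by
      simp [hw]; ring
    rw [div_div, ← mul_pow]
    have hrv : 0 < r * ‖v x‖ := by positivity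
    refine norm_inv_sq_sub_inv_sq_le hrv ?_ ?_ ?_
    · rw [ea, norm_mul, Complex.norm_ofNat]
      linarith
    · rw [eb, norm_mul, Complex.norm_ofNat]
      have := mul_le_mul_of_nonneg_left hvw hr.le
      linarith
    · have h1 : (2 + 2 * τ - 4 * (x 0 * τ + x 1) - (2 * τ - 4 * (x 0 * τ + x 1)) : ℂ) = 2 := by ring
      rw [h1]
      simp

/-- The `+ 1` in the constant covers `x = 0`, where the subtracted term is `1 / 0 = 0` and the
summand is `1 / 4`. -/
theorem norm_summand_two_le {τ : ℂ} (hτ : |τ.re| ≤ 1 ∧ 1 ≤ τ.im) (x : Fin 2 → ℤ) :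
    ‖(1 / (2 - 4 * (x 0 * τ + x 1)) ^ 2 - 1 / (4 * (x 0 * τ + x 1)) ^ 2 : ℂ)‖ ≤
      (4 / EisensteinSeries.r ⟨⟨1, 1⟩, one_pos⟩ ^ 3 + 1) /
        ‖(![- 2 * x 0, 1 - 2 * x 1] : Fin 2 → ℤ)‖ ^ 3 := by
  set r := EisensteinSeries.r ⟨⟨1, 1⟩, one_pos⟩
  have hr : 0 < r := EisensteinSeries.r_pos _
  set v : Fin 2 → ℤ := ![- 2 * x 0, 1 - 2 * x 1] with hv
  have hv1 : 1 ≤ ‖v‖ := one_le_norm_int_pair fun h => by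
    have := congrFun h 1
    simp [hv] at this
    omega
  by_cases hx : x = 0
  · have h1 : ‖v‖ = 1 := by
      refine le_antisymm ((pi_norm_le_iff_of_nonneg zero_le_one).mpr fun i => ?_) hv1
      fin_cases i <;> simp [hv, hx]
    rw [h1]
    simp only [hx]
    have : 0 < 4 / r ^ 3 := by positivity
    norm_num
    linarith
  · have hx1 := one_le_norm_int_pair hx
    have hvx : ‖v‖ ≤ 3 * ‖x‖ := by
      refine (pi_norm_le_iff_of_nonneg (by positivity)).mpr fun i => ?_
      have h0 := norm_le_pi_norm x 0
      have h1 := norm_le_pi_norm x 1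
      rw [Int.norm_eq_abs] at h0 h1
      have h0' := abs_le.mp h0
      have h1' := abs_le.mp h1
      fin_cases i
      · simp only [hv, Int.norm_eq_abs]
        rw [abs_le]
        constructor <;> simp <;> linarith
      · simp only [hv, Int.norm_eq_abs]
        rw [abs_le]
        constructor <;> simp <;> linarith
    have ha := norm_int_combination_ge one_pos hτ.1 hτ.2 v
    have hb := norm_int_combination_ge one_pos hτ.1 hτ.2 x
    have ea : (2 - 4 * (x 0 * τ + x 1) : ℂ) = 2 * (v 0 * τ + v 1) := by
      simp [hv]; ring
    have hrv : 0 < r * ‖v‖ := by positivity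
    have h5 : ‖(1 / (2 - 4 * (x 0 * τ + x 1)) ^ 2 - 1 / (4 * (x 0 * τ + x 1)) ^ 2 : ℂ)‖ ≤ 4 / (r * ‖v‖) ^ 3 := by
      -- After this sign change the two bases differ by exactly `2`.
      rw [← neg_sq (4 * (x 0 * τ + x 1) : ℂ)]
      refine norm_inv_sq_sub_inv_sq_le hrv ?_ ?_ ?_
      · rw [ea, norm_mul, Complex.norm_ofNat]
        linarith
      · rw [norm_neg, norm_mul, Complex.norm_ofNat]
        have := mul_le_mul_of_nonneg_left hvx hr.le
        linarith
      · simp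
    refine h5.trans ?_
    rw [mul_pow, ← div_div]
    gcongr
    linarith

theorem one_div_sq_sub_add_reflect_nonneg (k : ℤ) :
    0 ≤ 1 / (2 - 4 * k : ℝ) ^ 2 - 1 / (4 * k : ℝ) ^ 2 +
      (1 / (2 - 4 * -k : ℝ) ^ 2 - 1 / (4 * -k : ℝ) ^ 2) := by
  by_cases hk : k = 0
  · simp [hk]
  · obtain ⟨m, hm⟩ : ∃ m : ℝ, m = k := ⟨_, rfl⟩
    have h1 : 1 ≤ m ^ 2 := by
      rw [hm]
      have : 0 < (k) ^ 2 := by positivity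
      exact_mod_cast this
    rw [← hm]
    have h2 : (2 - 4 * m) ≠ 0 := fun h => by nlinarith
    have h3 : (2 - 4 * -m) ≠ 0 := fun h => by nlinarith
    have h4 : m ≠ 0 := by rintro rfl; norm_num at h1
    have h5 : 1 / (2 - 4 * m) ^ 2 - 1 / (4 * m) ^ 2 +
        (1 / (2 - 4 * -m) ^ 2 - 1 / (4 * -m) ^ 2) =
        (48 * m ^ 2 - 4) / (8 * m ^ 2 * (1 - 2 * m) ^ 2 * (1 + 2 * m) ^ 2) / 4 := by
      have h6 : (1 - 2 * m) ≠ 0 := fun h => h2 (by linarith)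
      have h7 : (1 + 2 * m) ≠ 0 := fun h => h3 (by linarith)
      have e1 : 2 - 4 * m = 2 * (1 - 2 * m) := by ring
      have e2 : 2 - 4 * -m = 2 * (1 + 2 * m) := by ring
      rw [e1, e2]
      field_simp
      ring
    rw [h5]
    have : 0 ≤ 48 * m ^ 2 - 4 := by linarith
    positivity

theorem tsum_pos_of_add_reflect_nonneg {ι : Type*} [AddGroup ι] {g : ι → ℝ} (hg : Summable g)
    (h : ∀ x, 0 ≤ g x + g (-x)) (h0 : 0 < g 0) : 0 < ∑' x, g x := by
  have h1 : Summable fun x => g (-x) := (Equiv.neg ι).summable_iff.mpr hg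
  have h2 : ∑' x, g (-x) = ∑' x, g x := (Equiv.neg ι).tsum_eq g
  have h3 := (hg.add h1).tsum_pos h 0 (by simpa using h0)
  rw [hg.tsum_add h1, h2] at h3
  linarith

/-- Only the terms with `x 0 = 0` survive at the cusp. Their sum is a real series, positive because
the terms at `k` and `-k` add up to something nonnegative and the term at `0` is positive. -/
theorem exists_tendsto_halfPeriodValue_zero : ∃ A : ℂ, A ≠ 0 ∧ Tendsto (e 0) I∞ (𝓝 A) := by
  set r := EisensteinSeries.r ⟨⟨1, 1⟩, one_pos⟩
  have hr : 0 < r := EisensteinSeries.r_pos _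
  set v : (Fin 2 → ℤ) → (Fin 2 → ℤ) := fun x => ![- 2 * x 0, 1 - 2 * x 1] with hv
  have hvi : Function.Injective v := by
    intro x y hxy
    have h0 := congrFun hxy 0
    have h1 := congrFun hxy 1
    simp [hv] at h0 h1
    ext i
    fin_cases i
    · exact h0
    · exact h1
  set f : ℂ → (Fin 2 → ℤ) → ℂ := fun τ x =>
    1 / (2 - 4 * (x 0 * τ + x 1)) ^ 2 - 1 / (4 * (x 0 * τ + x 1)) ^ 2 with hf
  set g : (Fin 2 → ℤ) → ℝ := fun x =>
    if x 0 = 0 then 1 / (2 - 4 * x 1 : ℝ) ^ 2 - 1 / (4 * x 1 : ℝ) ^ 2 else 0 with hg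
  have hlim : ∀ x, Tendsto (f · x) (I∞ ⊓ 𝓟 {τ | |τ.re| ≤ 1}) (𝓝 (g x : ℂ)) := by
    intro x
    refine Tendsto.mono_left ?_ inf_le_left
    by_cases hx : x 0 = 0
    · simp only [hf, hg, hx, if_true]
      push_cast
      simp only [zero_mul, zero_add]
      exact tendsto_const_nhds
    · have hn : (- 4 * x 0 : ℤ) ≠ 0 := by omega
      have hn' : (4 * x 0 : ℤ) ≠ 0 := by omega
      have h1 := (tendsto_one_div_sq_linear (2 - 4 * x 1) hn).sub
        (tendsto_one_div_sq_linear (4 * x 1) hn')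
      rw [sub_zero] at h1
      simp only [hg, hx, if_false, Complex.ofReal_zero]
      refine h1.congr fun τ => ?_
      simp only [hf]
      push_cast
      ring_nf
  have hsum := summable_const_mul_inv_norm_cube hvi (4 / r ^ 3 + 1)
  have hbound : ∀ᶠ τ in I∞ ⊓ 𝓟 {τ | |τ.re| ≤ 1}, ∀ x, ‖f τ x‖ ≤ (4 / r ^ 3 + 1) / ‖v x‖ ^ 3 := by
    filter_upwards [eventually_mem_strip] with τ hτ x
    exact norm_summand_two_le hτ x
  have hgb : ∀ x, ‖(g x : ℂ)‖ ≤ (4 / r ^ 3 + 1) / ‖v x‖ ^ 3 := fun x =>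
    le_of_tendsto (hlim x).norm (hbound.mono fun τ h => h x)
  have hgs : Summable g := hsum.of_norm_bounded fun x => by simpa using hgb x
  have hnonneg : ∀ x, 0 ≤ g x + g (-x) := by
    intro x
    by_cases hx : x 0 = 0
    · simp only [hg, hx, Pi.neg_apply, neg_zero, if_true]
      push_cast
      exact one_div_sq_sub_add_reflect_nonneg (x 1)
    · simp [hg, hx]
  have hpos : 0 < ∑' x, g x := tsum_pos_of_add_reflect_nonneg hgs hnonneg (by simp [hg])
  refine ⟨((∑' x, g x : ℝ) : ℂ), ?_, ?_⟩
  · exact_mod_cast hpos.ne'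
  · refine tendsto_of_periodic_of_strip (periodic_halfPeriodValue 0) ?_
    have h := tendsto_tsum_of_dominated_convergence hsum hlim hbound
    rw [Complex.ofReal_tsum]
    refine h.congr' ?_
    filter_upwards [eventually_mem_strip] with τ hτ
    have him : τ.im ≠ 0 := by linarith [hτ.2]
    exact (hasSum_wp him 2).tsum_eq

end Analytic

/-! ### Algebraic relations between quarter-period values, `λ` and Burnside's function. -/

section BurnsideAlgebra

local notation "e" => halfPeriodValue

theorem rat_combination_mem_lattice {τ : ℂ} (hτ : τ.im ≠ 0) (α β : ℚ) :
    (α * 4 + β * (4 * τ) : ℂ) ∈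
      (PeriodPair.mk (2 * 2) (2 * (2 * τ)) (linearIndependent_periods hτ)).lattice ↔
      α.den = 1 ∧ β.den = 1 := by
  rw [← PeriodPair.mul_ω₁_add_mul_ω₂_mem_lattice]
  have h : (α * 4 + β * (4 * τ) : ℂ) = α * (2 * 2) + β * (2 * (2 * τ)) := by ring
  rw [h]

/-- In rational coordinates lattice membership is a statement about denominators, which `norm_num`
decides at each concrete point. -/
theorem exists_wp_mul_eq_const {τ : ℂ} (hτ : τ.im ≠ 0) {α β : ℚ} (h : ¬ (α.den = 1 ∧ β.den = 1))
    (h2 : (2 * α).den = 1 ∧ (2 * β).den = 1) :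
    ∃ C : ℂ, C ≠ 0 ∧ ∀ γ δ : ℚ, ¬ (γ.den = 1 ∧ δ.den = 1) →
      ¬ ((γ - α).den = 1 ∧ (δ - β).den = 1) →
      (wp (γ * 4 + δ * (4 * τ)) 2 (2 * τ) - wp (α * 4 + β * (4 * τ)) 2 (2 * τ)) *
      (wp (γ * 4 + δ * (4 * τ) - (α * 4 + β * (4 * τ))) 2 (2 * τ) -
        wp (α * 4 + β * (4 * τ)) 2 (2 * τ)) = C := by
  simp only [wp_eq_weierstrassP hτ, ← rat_combination_mem_lattice hτ] at h h2 ⊢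
  push_cast at h2 ⊢
  obtain ⟨C, hC, H⟩ := PeriodPair.exists_weierstrassP_mul_eq_const h (by convert h2 using 1; ring)
  refine ⟨C, hC, fun γ δ h3 h4 => H _ h3 ?_⟩
  convert h4 using 2
  ring

/-- Take `h = 2` in the constant product: at `z = 1` the shifted point is `-1`, so evenness gives a
square, while `z = 2τ` evaluates the constant. -/
theorem wp_one_sub_sq {τ : ℂ} (hτ : τ.im ≠ 0) :
    (wp 1 2 (2 * τ) - e 0 τ) ^ 2 = (e 0 τ - e 2 τ) * (e 0 τ - e 1 τ) ∧
      (e 0 τ - e 2 τ) * (e 0 τ - e 1 τ) ≠ 0 := by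
  obtain ⟨C, hC, H⟩ := exists_wp_mul_eq_const hτ (α := 1 / 2) (β := 0) (by norm_num)
    (by norm_num)
  have h1 := H (1 / 4) 0 (by norm_num) (by norm_num)
  have h2 := H 0 (1 / 2) (by norm_num) (by norm_num)
  push_cast at h1 h2
  have a1 : (1 / 4 * 4 + 0 * (4 * τ) : ℂ) = 1 := by ring
  have a2 : (1 / 2 * 4 + 0 * (4 * τ) : ℂ) = 2 := by ring
  have a3 : (0 * 4 + 1 / 2 * (4 * τ) : ℂ) = 2 * τ := by ring
  have a4 : (1 - 2 : ℂ) = -1 := by norm_num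
  have a5 : wp (2 * τ - 2) 2 (2 * τ) = wp (2 + 2 * τ) 2 (2 * τ) := by
    rw [← wp_add_period (2 * τ - 2) 1 0]
    congr 1
    push_cast
    ring
  rw [a1, a2, a4, wp_neg] at h1
  rw [a2, a3, a5] at h2
  simp only [halfPeriodValue_zero, halfPeriodValue_one, halfPeriodValue_two]
  have h3 : (wp 2 2 (2 * τ) - wp (2 * τ) 2 (2 * τ)) *
      (wp 2 2 (2 * τ) - wp (2 + 2 * τ) 2 (2 * τ)) = C := by linear_combination h2
  exact ⟨by linear_combination h1 - h3, h3 ▸ hC⟩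

theorem wp_tau_sub_sq {τ : ℂ} (hτ : τ.im ≠ 0) :
    (wp τ 2 (2 * τ) - e 2 τ) ^ 2 = (e 0 τ - e 2 τ) * (e 1 τ - e 2 τ) ∧
      (e 0 τ - e 2 τ) * (e 1 τ - e 2 τ) ≠ 0 := by
  obtain ⟨C, hC, H⟩ := exists_wp_mul_eq_const hτ (α := 0) (β := 1 / 2) (by norm_num)
    (by norm_num)
  have h1 := H 0 (1 / 4) (by norm_num) (by norm_num)
  have h2 := H (1 / 2) 0 (by norm_num) (by norm_num)
  push_cast at h1 h2
  have a1 : (0 * 4 + 1 / 4 * (4 * τ) : ℂ) = τ := by ring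
  have a2 : (1 / 2 * 4 + 0 * (4 * τ) : ℂ) = 2 := by ring
  have a3 : (0 * 4 + 1 / 2 * (4 * τ) : ℂ) = 2 * τ := by ring
  have a4 : (τ - 2 * τ : ℂ) = -τ := by ring
  have a5 : wp (2 - 2 * τ) 2 (2 * τ) = wp (2 + 2 * τ) 2 (2 * τ) := by
    rw [← wp_add_period (2 - 2 * τ) 0 1]
    congr 1
    push_cast
    ring
  rw [a1, a3, a4, wp_neg] at h1
  rw [a2, a3, a5] at h2
  simp only [halfPeriodValue_zero, halfPeriodValue_one, halfPeriodValue_two]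
  exact ⟨by linear_combination h1 - h2, h2 ▸ hC⟩

theorem halfPeriodValue_injective {τ : ℂ} (hτ : τ.im ≠ 0) :
    Function.Injective fun i => e i τ := by
  have h1 := (wp_one_sub_sq hτ).2
  have h2 := (wp_tau_sub_sq hτ).2
  have h02 : e 0 τ ≠ e 2 τ := sub_ne_zero.mp (left_ne_zero_of_mul h1)
  have h01 : e 0 τ ≠ e 1 τ := sub_ne_zero.mp (right_ne_zero_of_mul h1)
  have h12 : e 1 τ ≠ e 2 τ := sub_ne_zero.mp (right_ne_zero_of_mul h2)
  intro i j hij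
  fin_cases i <;> fin_cases j <;> simp_all [h02.symm, h01.symm, h12.symm]

theorem halfPeriodValue_sub_ne_zero {τ : ℂ} (hτ : τ.im ≠ 0) {i j : Fin 3} (hij : i ≠ j) :
    e i τ - e j τ ≠ 0 :=
  sub_ne_zero.mpr fun h => hij (halfPeriodValue_injective hτ h)

/-- As `℘'` vanishes at half-periods, these are three distinct roots of `4X³ - g₂X - g₃`, which has
no quadratic term. -/
theorem halfPeriodValue_sum {τ : ℂ} (hτ : τ.im ≠ 0) : e 0 τ + e 1 τ + e 2 τ = 0 := by
  set L := PeriodPair.mk (2 * 2) (2 * (2 * τ)) (linearIndependent_periods hτ) with hL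
  have key (α β : ℚ) (h : ¬ (α.den = 1 ∧ β.den = 1)) (h2 : (2 * α).den = 1 ∧ (2 * β).den = 1) :
      0 = 4 * wp (α * 4 + β * (4 * τ)) 2 (2 * τ) ^ 3 -
        L.g₂ * wp (α * 4 + β * (4 * τ)) 2 (2 * τ) - L.g₃ := by
    rw [← rat_combination_mem_lattice hτ] at h h2
    rw [wp_eq_weierstrassP hτ, ← L.derivWeierstrassP_sq _ h,
      PeriodPair.derivWeierstrassP_half (by convert h2 using 1; push_cast; ring)]
    ring
  have h0 := key (1 / 2) 0 (by norm_num) (by norm_num)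
  have h1 := key (1 / 2) (1 / 2) (by norm_num) (by norm_num)
  have h2 := key 0 (1 / 2) (by norm_num) (by norm_num)
  push_cast at h0 h1 h2
  have a0 : (1 / 2 * 4 + 0 * (4 * τ) : ℂ) = 2 := by ring
  have a1 : (1 / 2 * 4 + 1 / 2 * (4 * τ) : ℂ) = 2 + 2 * τ := by ring
  have a2 : (0 * 4 + 1 / 2 * (4 * τ) : ℂ) = 2 * τ := by ring
  rw [a0, ← halfPeriodValue_zero] at h0
  rw [a1, ← halfPeriodValue_one] at h1
  rw [a2, ← halfPeriodValue_two] at h2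
  have d01 := halfPeriodValue_sub_ne_zero hτ (i := 0) (j := 1) (by decide)
  have d02 := halfPeriodValue_sub_ne_zero hτ (i := 0) (j := 2) (by decide)
  have d12 := halfPeriodValue_sub_ne_zero hτ (i := 1) (j := 2) (by decide)
  refine mul_left_cancel₀ (mul_ne_zero d01 (mul_ne_zero d02 d12)) ?_
  linear_combination (1 / 4) * (-(e 1 τ - e 2 τ) * h0 + (e 0 τ - e 2 τ) * h1 -
    (e 0 τ - e 1 τ) * h2)

/-- The modular lambda function, as a cross ratio of half-period values. -/
noncomputable def modularLambda (τ : ℂ) : ℂ := (e 1 τ - e 2 τ) / (e 0 τ - e 2 τ)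

/-- The rational function through which the modular lambda function factors over Burnside's
function. -/
noncomputable def burnsideCover (x : ℂ) : ℂ := ((x ^ 2 - 1) / (x ^ 2 + 1)) ^ 2

theorem modularLambda_ne_zero {τ : ℂ} (hτ : τ.im ≠ 0) : modularLambda τ ≠ 0 :=
  div_ne_zero (halfPeriodValue_sub_ne_zero hτ (by decide))
    (halfPeriodValue_sub_ne_zero hτ (by decide))

theorem modularLambda_ne_one {τ : ℂ} (hτ : τ.im ≠ 0) : modularLambda τ ≠ 1 := by
  have h1 := halfPeriodValue_sub_ne_zero hτ (i := 0) (j := 2) (by decide)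
  have h2 := halfPeriodValue_sub_ne_zero hτ (i := 0) (j := 1) (by decide)
  rw [modularLambda, Ne, div_eq_one_iff_eq h1]
  exact fun h => h2 (by linear_combination -h)

theorem modularLambda_neg (τ : ℂ) : modularLambda (-τ) = modularLambda τ := by
  simp only [modularLambda, halfPeriodValue_neg]

theorem burnsideX_neg (τ : ℂ) : burnsideX (-τ) = burnsideX τ := by
  rw [burnsideX, burnsideX, wp_neg_period, wp_neg_period, wp_neg_period, wp_neg]

/-- Burnside's function in terms of quarter-period values: with `u = ℘(1) - e 0` and
`v = ℘(τ) - e 2` one has `u² + v² = (e 0 - e 2)²`. -/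
theorem burnsideX_spec {τ : ℂ} (hτ : τ.im ≠ 0) :
    burnsideX τ ^ 5 - burnsideX τ ≠ 0 ∧ burnsideCover (burnsideX τ) = modularLambda τ ∧
      wp τ 2 (2 * τ) * (3 * (burnsideX τ ^ 2 + 1) ^ 2) =
        (e 0 τ - e 2 τ) * (burnsideX τ ^ 4 - 5) ∧
      wp τ 2 (2 * τ) - wp 2 2 (2 * τ) ≠ 0 := by
  obtain ⟨hu, hu0⟩ := wp_one_sub_sq hτ
  obtain ⟨hv, hv0⟩ := wp_tau_sub_sq hτ
  have hs := halfPeriodValue_sum hτ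
  have hx : burnsideX τ = (wp 1 2 (2 * τ) - e 0 τ) / (wp τ 2 (2 * τ) - e 0 τ) := rfl
  have hb : wp τ 2 (2 * τ) - wp 2 2 (2 * τ) = wp τ 2 (2 * τ) - e 0 τ := rfl
  rw [hb]
  rw [modularLambda]
  set x := burnsideX τ
  set b := wp τ 2 (2 * τ)
  set u := wp 1 2 (2 * τ) - e 0 τ
  obtain ⟨d, hd⟩ : ∃ d, d = e 0 τ - e 2 τ := ⟨_, rfl⟩
  obtain ⟨v, hvd⟩ : ∃ v, v = b - e 2 τ := ⟨_, rfl⟩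
  have h12 : d * (e 1 τ - e 2 τ) = v ^ 2 := by rw [hvd, hv, hd]
  have huv : u ^ 2 = d ^ 2 - v ^ 2 := by rw [hu, ← h12, hd]; ring
  have hd0 : d ≠ 0 := by rw [hd]; exact left_ne_zero_of_mul hu0
  have hu0' : u ≠ 0 := fun h => hu0 (by rw [← hu, h]; ring)
  have hv0' : v ≠ 0 := fun h => hv0 (by rw [← hv, ← hvd, h]; ring)
  have hprod : (d - v) * (d + v) ≠ 0 := by
    have : (d - v) * (d + v) = u ^ 2 := by rw [huv]; ring
    rw [this]; exact pow_ne_zero 2 hu0'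
  have h1 : d - v ≠ 0 := left_ne_zero_of_mul hprod
  have hbe : b - e 0 τ = v - d := by rw [hvd, hd]; ring
  have h1' : v - d ≠ 0 := fun h => h1 (by linear_combination -h)
  rw [hbe] at hx
  have hx1 : x * (v - d) = u := by rw [hx]; field_simp
  have hx2 : x ^ 2 * (d - v) = d + v := by
    refine mul_left_cancel₀ h1 ?_
    linear_combination (x * (v - d) + u) * hx1 + huv
  have hx0 : x ≠ 0 := fun h => hu0' (by rw [← hx1, h, zero_mul])
  -- These two relations give `v / d = (x² - 1) / (x² + 1)`, and `λ = (v / d)²`.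
  have hp : (x ^ 2 + 1) * (d - v) = 2 * d := by linear_combination hx2
  have hm : (x ^ 2 - 1) * (d - v) = 2 * v := by linear_combination hx2
  have hp0 : x ^ 2 + 1 ≠ 0 := left_ne_zero_of_mul (hp ▸ mul_ne_zero two_ne_zero hd0)
  have hm0 : x ^ 2 - 1 ≠ 0 := left_ne_zero_of_mul (hm ▸ mul_ne_zero two_ne_zero hv0')
  have hv' : v * (x ^ 2 + 1) = d * (x ^ 2 - 1) := by
    refine mul_left_cancel₀ h1 ?_
    linear_combination v * hp - d * hm
  refine ⟨?_, ?_, ?_, by rw [hbe]; exact h1'⟩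
  · have : x ^ 5 - x = x * ((x ^ 2 - 1) * (x ^ 2 + 1)) := by ring
    rw [this]
    exact mul_ne_zero hx0 (mul_ne_zero hm0 hp0)
  · rw [burnsideCover, ← hd, div_pow, div_eq_div_iff (pow_ne_zero 2 hp0) hd0]
    refine mul_left_cancel₀ hd0 ?_
    linear_combination -(x ^ 2 + 1) ^ 2 * h12 - (v * (x ^ 2 + 1) + d * (x ^ 2 - 1)) * hv'
  -- The vanishing sum of the `eᵢ` gives `3 e₂ = -(d + v² / d)`, and `b = v + e₂`.
  · have hb3 : 3 * d * b = 3 * d * v - d ^ 2 - v ^ 2 := by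
      linear_combination d * hs - 3 * d * hvd + d * hd - h12
    rw [← hd]
    refine mul_left_cancel₀ hd0 ?_
    linear_combination (x ^ 2 + 1) ^ 2 * hb3 + (3 * d * (x ^ 2 + 1) - v * (x ^ 2 + 1) - d * (x ^ 2 - 1)) * hv'

theorem continuousOn_burnsideX : ContinuousOn burnsideX {τ : ℂ | 0 < τ.im} := by
  have key (n : ℤ) (hn : (1 : ℝ) = 4 * n) : False := by
    have h1 : (1 : ℤ) = 4 * n := by exact_mod_cast hn
    omega
  have h1 : ContinuousOn (fun τ : ℂ => wp 1 2 (2 * τ)) {τ : ℂ | 0 < τ.im} := by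
    simpa using (differentiableOn_wp_period 1 0
      (by rintro ⟨m, n, h, -⟩; exact key m h)).continuousOn
  have h2 : ContinuousOn (fun τ : ℂ => wp τ 2 (2 * τ)) {τ : ℂ | 0 < τ.im} := by
    simpa using (differentiableOn_wp_period 0 1
      (by rintro ⟨m, n, -, h⟩; exact key n h)).continuousOn
  have h3 : ContinuousOn (fun τ : ℂ => wp 2 2 (2 * τ)) {τ : ℂ | 0 < τ.im} :=
    (differentiableOn_halfPeriodValue 0).continuousOn
  refine (h1.sub h3).div (h2.sub h3) fun τ hτ => ?_
  exact (burnsideX_spec (ne_of_gt hτ)).2.2.2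

end BurnsideAlgebra

/-! ### Differential relations between the half-period values. -/

section Halphen

local notation "e" => halfPeriodValue
local notation "I∞" => comap im atTop

theorem isOpen_im_pos : IsOpen {τ : ℂ | 0 < τ.im} := isOpen_lt continuous_const continuous_im

theorem eventually_im_pos {τ : ℂ} (hτ : 0 < τ.im) : ∀ᶠ z in 𝓝 τ, 0 < z.im :=
  isOpen_im_pos.mem_nhds hτ

theorem im_neg_one_div_pos {τ : ℂ} (hτ : 0 < τ.im) : 0 < (-1 / τ).im := by
  have h0 : τ ≠ 0 := by rintro rfl; simp at hτ
  have := normSq_pos.mpr h0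
  rw [neg_div, one_div, neg_im, inv_im, neg_div, neg_neg]
  positivity

theorem hasDerivAt_neg_one_div {τ : ℂ} (h0 : τ ≠ 0) :
    HasDerivAt (fun z : ℂ => -1 / z) (1 / τ ^ 2) τ := by
  have h := (hasDerivAt_inv h0).neg
  refine (h.congr_deriv (by field_simp)).congr_of_eventuallyEq (.of_forall fun z => ?_)
  simp [div_eq_mul_inv]

theorem hasDerivAt_halfPeriodValue (i : Fin 3) {τ : ℂ} (hτ : 0 < τ.im) :
    HasDerivAt (e i) (deriv (e i) τ) τ :=
  ((differentiableOn_halfPeriodValue i).differentiableAt (isOpen_im_pos.mem_nhds hτ)).hasDerivAt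

theorem differentiableOn_deriv_halfPeriodValue (i : Fin 3) :
    DifferentiableOn ℂ (deriv (e i)) {τ : ℂ | 0 < τ.im} :=
  (differentiableOn_halfPeriodValue i).deriv isOpen_im_pos

theorem deriv_halfPeriodValue_add_one (i : Fin 3) (τ : ℂ) :
    deriv (e i) (τ + 1) = deriv (e (Equiv.swap 1 2 i)) τ := by
  rw [← deriv_comp_add_const]
  congr 1
  exact funext fun z => halfPeriodValue_add_one i z

theorem deriv_halfPeriodValue_inv (i : Fin 3) {τ : ℂ} (hτ : 0 < τ.im) :
    deriv (e i) (-1 / τ) =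
      τ ^ 4 * deriv (e (Equiv.swap 0 2 i)) τ + 2 * τ ^ 3 * e (Equiv.swap 0 2 i) τ := by
  have h0 : τ ≠ 0 := by rintro rfl; simp at hτ
  have h1 := (hasDerivAt_halfPeriodValue i (im_neg_one_div_pos hτ)).comp τ
    (hasDerivAt_neg_one_div h0)
  have h2 := (hasDerivAt_pow 2 τ).fun_mul (hasDerivAt_halfPeriodValue (Equiv.swap 0 2 i) hτ)
  have h3 : (e i ∘ fun z => -1 / z) =ᶠ[𝓝 τ] fun z => z ^ 2 * e (Equiv.swap 0 2 i) z := by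
    filter_upwards [eventually_im_pos hτ] with z hz
    exact halfPeriodValue_inv i hz.ne'
  have h4 := h1.unique (h2.congr_of_eventuallyEq h3)
  have h5 : deriv (e i) (-1 / τ) = deriv (e i) (-1 / τ) * (1 / τ ^ 2) * τ ^ 2 := by field_simp
  rw [h5, h4]
  push_cast
  ring

theorem exists_tendsto_halfPeriodValue : ∃ A : ℂ, A ≠ 0 ∧ Tendsto (e 0) I∞ (𝓝 (2 * A)) ∧
    Tendsto (e 1) I∞ (𝓝 (-A)) ∧ Tendsto (e 2) I∞ (𝓝 (-A)) := by
  obtain ⟨A, hA, h0⟩ := exists_tendsto_halfPeriodValue_zero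
  have h12 := tendsto_halfPeriodValue_one_sub_two
  refine ⟨A / 2, by simpa using hA, by simpa [mul_div_cancel₀] using h0, ?_, ?_⟩
  · have h := (h12.sub h0).div_const 2
    have h2 : (0 - A) / 2 = -(A / 2) := by ring
    rw [h2] at h
    refine h.congr' ?_
    filter_upwards [eventually_im_gt 0] with τ hτ
    linear_combination (-1 / 2) * halfPeriodValue_sum hτ.ne'
  · have h := (h12.add h0).div_const (-2)
    have h2 : (0 + A) / (-2) = -(A / 2) := by ring
    rw [h2] at h
    refine h.congr' ?_
    filter_upwards [eventually_im_gt 0] with τ hτ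
    linear_combination (-1 / 2) * halfPeriodValue_sum hτ.ne'

/-- The half-period values satisfy a first-order relation: the alternating expression in the
values and their derivatives is a constant multiple of the product of the differences. -/
theorem exists_wronskian_eq : ∃ c : ℂ, c ≠ 0 ∧ ∀ τ : ℂ, 0 < τ.im →
    (deriv (e 1) τ - deriv (e 2) τ) * (e 0 τ - e 1 τ) -
      (deriv (e 0) τ - deriv (e 1) τ) * (e 1 τ - e 2 τ) =
    c * ((e 1 τ - e 2 τ) * (e 0 τ - e 1 τ) * (e 0 τ - e 2 τ)) := by
  obtain ⟨A, hA, h0, h1, h2⟩ := exists_tendsto_halfPeriodValue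
  have hne {i j : Fin 3} (hij : i ≠ j) {τ : ℂ} (hτ : 0 < τ.im) : e i τ - e j τ ≠ 0 :=
    halfPeriodValue_sub_ne_zero hτ.ne' hij
  have n12 : (1 : Fin 3) ≠ 2 := by decide
  have n01 : (0 : Fin 3) ≠ 1 := by decide
  have n02 : (0 : Fin 3) ≠ 2 := by decide
  have hden : ∀ τ : ℂ, 0 < τ.im → (e 1 τ - e 2 τ) * (e 0 τ - e 1 τ) * (e 0 τ - e 2 τ) ≠ 0 :=
    fun τ hτ => mul_ne_zero (mul_ne_zero (hne n12 hτ) (hne n01 hτ)) (hne n02 hτ)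
  -- Numerator and denominator both have weight 6 and change sign under the transpositions induced
  -- by `T` and `S`, so the quotient is of level one and weight zero.
  set P : ℂ → ℂ := fun τ => ((deriv (e 1) τ - deriv (e 2) τ) * (e 0 τ - e 1 τ) -
      (deriv (e 0) τ - deriv (e 1) τ) * (e 1 τ - e 2 τ)) /
      ((e 1 τ - e 2 τ) * (e 0 τ - e 1 τ) * (e 0 τ - e 2 τ)) with hP
  have s10 : Equiv.swap (1 : Fin 3) 2 0 = 0 := by decide
  have s11 : Equiv.swap (1 : Fin 3) 2 1 = 2 := by decide
  have s12 : Equiv.swap (1 : Fin 3) 2 2 = 1 := by decide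
  have s00 : Equiv.swap (0 : Fin 3) 2 0 = 2 := by decide
  have s01 : Equiv.swap (0 : Fin 3) 2 1 = 1 := by decide
  have s02 : Equiv.swap (0 : Fin 3) 2 2 = 0 := by decide
  have e01 : Tendsto (fun τ => e 0 τ - e 1 τ) I∞ (𝓝 (2 * A - -A)) := h0.sub h1
  have e02 : Tendsto (fun τ => e 0 τ - e 2 τ) I∞ (𝓝 (2 * A - -A)) := h0.sub h2
  have e12 : Tendsto (fun τ => e 1 τ - e 2 τ) I∞ (𝓝 (-A - -A)) := h1.sub h2
  have hA3 : 2 * A - -A ≠ 0 := by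
    have : 2 * A - -A = 3 * A := by ring
    rw [this]
    exact mul_ne_zero three_ne_zero hA
  have hex : ∃ c : ℂ, ∀ τ : ℂ, 0 < τ.im → P τ = c := by
    refine levelOne_weight_zero_eq_const ?_ ?_ ?_ ?_
    · have hd := differentiableOn_halfPeriodValue
      have hd' := differentiableOn_deriv_halfPeriodValue
      exact ((((hd' 1).sub (hd' 2)).mul ((hd 0).sub (hd 1))).sub
        (((hd' 0).sub (hd' 1)).mul ((hd 1).sub (hd 2)))).div
        ((((hd 1).sub (hd 2)).mul ((hd 0).sub (hd 1))).mul ((hd 0).sub (hd 2))) hden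
    · intro τ hτ
      simp only [hP, halfPeriodValue_add_one, deriv_halfPeriodValue_add_one, s10, s11, s12]
      have hden2 : (e 2 τ - e 1 τ) * (e 0 τ - e 2 τ) * (e 0 τ - e 1 τ) ≠ 0 := by
        have := hden τ hτ
        intro h
        exact this (by linear_combination -h)
      rw [div_eq_div_iff hden2 (hden τ hτ)]
      ring
    · intro τ hτ
      have hτ0 : τ ≠ 0 := by rintro rfl; simp at hτ
      simp only [hP, halfPeriodValue_inv _ hτ.ne', deriv_halfPeriodValue_inv _ hτ, s00, s01, s02]
      have hden2 : (τ ^ 2 * e 1 τ - τ ^ 2 * e 0 τ) * (τ ^ 2 * e 2 τ - τ ^ 2 * e 1 τ) *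
          (τ ^ 2 * e 2 τ - τ ^ 2 * e 0 τ) ≠ 0 := by
        have := mul_ne_zero (pow_ne_zero 6 hτ0) (hden τ hτ)
        intro h
        exact this (by linear_combination -h)
      rw [div_eq_div_iff hden2 (hden τ hτ)]
      ring
    -- Boundedness at the cusp: `P = (q' / q) / (e₀ - e₂)`, where `q` tends to `0` but has bounded
    -- logarithmic derivative.
    · set q : ℂ → ℂ := fun τ => (e 1 τ - e 2 τ) / (e 0 τ - e 1 τ) with hq
      have hqp : Function.Periodic q 2 := fun τ => by
        simp only [hq, (periodic_halfPeriodValue _) τ]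
      have hqd : ∀ τ : ℂ, 0 < τ.im → HasDerivAt q
          (((deriv (e 1) τ - deriv (e 2) τ) * (e 0 τ - e 1 τ) -
            (e 1 τ - e 2 τ) * (deriv (e 0) τ - deriv (e 1) τ)) / (e 0 τ - e 1 τ) ^ 2) τ := by
        intro τ hτ
        exact ((hasDerivAt_halfPeriodValue 1 hτ).sub (hasDerivAt_halfPeriodValue 2 hτ)).fun_div
          ((hasDerivAt_halfPeriodValue 0 hτ).sub (hasDerivAt_halfPeriodValue 1 hτ)) (hne n01 hτ)
      have hb := bounded_logDeriv_of_periodic hqp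
        (by filter_upwards [eventually_im_gt 0] with τ hτ using (hqd τ hτ).differentiableAt)
        ((e12.div e01 hA3).isBigO_one ℝ)
        (by filter_upwards [eventually_im_gt 0] with τ hτ using div_ne_zero (hne n12 hτ) (hne n01 hτ))
      have hb2 : BoundedAtFilter I∞ fun τ => (deriv q τ / q τ) * (e 0 τ - e 2 τ)⁻¹ :=
        hb.mul ((e02.inv₀ hA3).isBigO_one ℝ)
      have hb3 : BoundedAtFilter I∞ P := by
        refine hb2.congr' ?_ (by rfl)
        filter_upwards [eventually_im_gt 0] with τ hτ
        rw [(hqd τ hτ).deriv]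
        simp only [hP, hq]
        have a1 := hne n12 hτ
        have a2 := hne n01 hτ
        have a3 := hne n02 hτ
        field_simp
      obtain ⟨C, hC⟩ := hb3.bound
      obtain ⟨Y, hY⟩ := mem_comap.mp hC
      obtain ⟨y, hy⟩ := mem_atTop_sets.mp hY.1
      refine ⟨C, y, fun τ hτ => ?_⟩
      have := hY.2 (show τ ∈ im ⁻¹' Y from hy _ hτ.le)
      simpa using this
  obtain ⟨c, hc⟩ := hex
  have hrel : ∀ τ : ℂ, 0 < τ.im →
      (deriv (e 1) τ - deriv (e 2) τ) * (e 0 τ - e 1 τ) -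
        (deriv (e 0) τ - deriv (e 1) τ) * (e 1 τ - e 2 τ) =
      c * ((e 1 τ - e 2 τ) * (e 0 τ - e 1 τ) * (e 0 τ - e 2 τ)) := by
    intro τ hτ
    have h := hc τ hτ
    simp only [hP] at h
    rwa [div_eq_iff (hden τ hτ)] at h
  refine ⟨c, ?_, hrel⟩
  -- If `c = 0`, then `q` is constant, hence equal to its limit `0` at the cusp, although it never
  -- vanishes.
  rintro rfl
  set q : ℂ → ℂ := fun τ => (e 1 τ - e 2 τ) / (e 0 τ - e 1 τ) with hq
  have hqd : ∀ τ ∈ {τ : ℂ | 0 < τ.im}, HasDerivAt q 0 τ := by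
    intro τ hτ
    have h := ((hasDerivAt_halfPeriodValue 1 hτ).sub (hasDerivAt_halfPeriodValue 2 hτ)).fun_div
      ((hasDerivAt_halfPeriodValue 0 hτ).sub (hasDerivAt_halfPeriodValue 1 hτ)) (hne n01 hτ)
    refine h.congr_deriv ?_
    rw [div_eq_zero_iff]
    left
    simp only [Pi.sub_apply]
    linear_combination hrel τ hτ
  have hconst : ∀ τ : ℂ, 0 < τ.im → q τ = q I := by
    intro τ hτ
    have hconv : Convex ℝ {τ : ℂ | 0 < τ.im} := convex_halfSpace_im_gt 0
    exact hconv.is_const_of_fderivWithin_eq_zero (𝕜 := ℂ)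
      (fun z hz => (hqd z hz).differentiableAt.differentiableWithinAt)
      (fun z hz => by
        rw [fderivWithin_of_isOpen isOpen_im_pos hz]
        have := (hqd z hz).hasFDerivAt.fderiv
        rw [this]
        ext
        simp) hτ (by simp)
  have hlim := e12.div e01 hA3
  rw [sub_self, zero_div] at hlim
  have hlim2 : Tendsto q I∞ (𝓝 (q I)) :=
    tendsto_const_nhds.congr' (by
      filter_upwards [eventually_im_gt 0] with τ hτ
      exact (hconst τ hτ).symm)
  have hNB : (I∞ : Filter ℂ).NeBot :=
    (atTop_neBot (α := ℝ)).comap_of_surj fun y => ⟨y * I, by simp⟩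
  have hqI := tendsto_nhds_unique hlim2 hlim
  exact div_ne_zero (hne n12 (by simp)) (hne n01 (by simp)) hqI

/-- For `φ = (e₀ - e₂)' / (e₀ - e₂)` the anomalies of `φ' - φ² / 2` under `T` are cancelled by the
quadratic term in the `eᵢ`, and those under `S` cancel each other. The difference of the two sides
is a level-one cusp form of weight 4, hence zero. -/
theorem exists_halphen_system : ∃ c : ℂ, c ≠ 0 ∧ (∀ τ : ℂ, 0 < τ.im →
    (deriv (e 1) τ - deriv (e 2) τ) * (e 0 τ - e 1 τ) -
      (deriv (e 0) τ - deriv (e 1) τ) * (e 1 τ - e 2 τ) =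
    c * ((e 1 τ - e 2 τ) * (e 0 τ - e 1 τ) * (e 0 τ - e 2 τ))) ∧
    ∀ τ : ℂ, 0 < τ.im →
      HasDerivAt (fun τ => (deriv (e 0) τ - deriv (e 2) τ) / (e 0 τ - e 2 τ))
        (((deriv (e 0) τ - deriv (e 2) τ) / (e 0 τ - e 2 τ)) ^ 2 / 2 +
          c ^ 2 / 2 * ((e 0 τ - e 1 τ) * (e 1 τ - e 2 τ))) τ := by
  obtain ⟨c, hc0, hrel⟩ := exists_wronskian_eq
  refine ⟨c, hc0, hrel, ?_⟩
  obtain ⟨A, hA, h0, h1, h2⟩ := exists_tendsto_halfPeriodValue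
  have hne {i j : Fin 3} (hij : i ≠ j) {τ : ℂ} (hτ : 0 < τ.im) : e i τ - e j τ ≠ 0 :=
    halfPeriodValue_sub_ne_zero hτ.ne' hij
  have n12 : (1 : Fin 3) ≠ 2 := by decide
  have n01 : (0 : Fin 3) ≠ 1 := by decide
  have n02 : (0 : Fin 3) ≠ 2 := by decide
  have s10 : Equiv.swap (1 : Fin 3) 2 0 = 0 := by decide
  have s11 : Equiv.swap (1 : Fin 3) 2 1 = 2 := by decide
  have s12 : Equiv.swap (1 : Fin 3) 2 2 = 1 := by decide
  have s00 : Equiv.swap (0 : Fin 3) 2 0 = 2 := by decide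
  have s01 : Equiv.swap (0 : Fin 3) 2 1 = 1 := by decide
  have s02 : Equiv.swap (0 : Fin 3) 2 2 = 0 := by decide
  set φ : ℂ → ℂ := fun τ => (deriv (e 0) τ - deriv (e 2) τ) / (e 0 τ - e 2 τ) with hφ
  have hd := differentiableOn_halfPeriodValue
  have hd' := differentiableOn_deriv_halfPeriodValue
  have hφd : DifferentiableOn ℂ φ {τ : ℂ | 0 < τ.im} :=
    ((hd' 0).sub (hd' 2)).div ((hd 0).sub (hd 2)) fun τ hτ => hne n02 hτ
  have hφ' : ∀ τ : ℂ, 0 < τ.im → HasDerivAt φ (deriv φ τ) τ := fun τ hτ =>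
    (hφd.differentiableAt (isOpen_im_pos.mem_nhds hτ)).hasDerivAt
  have hφT : ∀ τ : ℂ, 0 < τ.im → φ (τ + 1) = φ τ - c * (e 1 τ - e 2 τ) := by
    intro τ hτ
    simp only [hφ, halfPeriodValue_add_one, deriv_halfPeriodValue_add_one, s10, s12]
    have a2 := hne n01 hτ
    have a3 := hne n02 hτ
    rw [div_eq_iff a2]
    field_simp
    linear_combination -hrel τ hτ
  have hφT' : ∀ τ : ℂ, 0 < τ.im →
      deriv φ (τ + 1) = deriv φ τ - c * (deriv (e 1) τ - deriv (e 2) τ) := by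
    intro τ hτ
    rw [← deriv_comp_add_const]
    have h3 : (fun z => φ (z + 1)) =ᶠ[𝓝 τ] fun z => φ z - c * (e 1 z - e 2 z) := by
      filter_upwards [eventually_im_pos hτ] with z hz using hφT z hz
    rw [h3.deriv_eq]
    exact ((hφ' τ hτ).fun_sub (((hasDerivAt_halfPeriodValue 1 hτ).fun_sub
      (hasDerivAt_halfPeriodValue 2 hτ)).const_mul c)).deriv
  have hφS : ∀ τ : ℂ, 0 < τ.im → φ (-1 / τ) = τ ^ 2 * φ τ + 2 * τ := by
    intro τ hτ
    have hτ0 : τ ≠ 0 := by rintro rfl; simp at hτ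
    simp only [hφ, halfPeriodValue_inv _ hτ.ne', deriv_halfPeriodValue_inv _ hτ, s00, s02]
    have a3 := hne n02 hτ
    have a4 : τ ^ 2 * e 2 τ - τ ^ 2 * e 0 τ ≠ 0 := fun h =>
      mul_ne_zero (pow_ne_zero 2 hτ0) a3 (by linear_combination -h)
    rw [div_eq_iff a4]
    field_simp
    ring
  have hφS' : ∀ τ : ℂ, 0 < τ.im →
      deriv φ (-1 / τ) = τ ^ 4 * deriv φ τ + 2 * τ ^ 3 * φ τ + 2 * τ ^ 2 := by
    intro τ hτ
    have hτ0 : τ ≠ 0 := by rintro rfl; simp at hτ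
    have g1 := (hφ' _ (im_neg_one_div_pos hτ)).comp τ (hasDerivAt_neg_one_div hτ0)
    have g2 := ((hasDerivAt_pow 2 τ).fun_mul (hφ' τ hτ)).fun_add ((hasDerivAt_id' τ).const_mul 2)
    have g3 : (φ ∘ fun z => -1 / z) =ᶠ[𝓝 τ] fun z => z ^ 2 * φ z + 2 * z := by
      filter_upwards [eventually_im_pos hτ] with z hz using hφS z hz
    have g4 := g1.unique (g2.congr_of_eventuallyEq g3)
    have g5 : deriv φ (-1 / τ) = deriv φ (-1 / τ) * (1 / τ ^ 2) * τ ^ 2 := by field_simp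
    rw [g5, g4]
    push_cast
    ring
  set K : ℂ → ℂ := fun τ => deriv φ τ - φ τ ^ 2 / 2 -
    c ^ 2 / 2 * ((e 0 τ - e 1 τ) * (e 1 τ - e 2 τ)) with hK
  have hKz : ∀ τ : ℂ, 0 < τ.im → K τ = 0 := by
    refine levelOne_cusp_eq_zero (k := 4) (by norm_num) ?_ ?_ ?_ ?_
    · exact ((hφd.deriv isOpen_im_pos).sub ((hφd.pow 2).div_const 2)).sub
        ((((hd 0).sub (hd 1)).mul ((hd 1).sub (hd 2))).const_mul _)
    · intro τ hτ
      have a3 := hne n02 hτ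
      have hφe : φ τ * (e 0 τ - e 2 τ) = deriv (e 0) τ - deriv (e 2) τ := by
        simp only [hφ]
        field_simp
      have key : deriv (e 1) τ - deriv (e 2) τ =
          (e 1 τ - e 2 τ) * (φ τ + c * (e 0 τ - e 1 τ)) := by
        refine mul_left_cancel₀ a3 ?_
        linear_combination hrel τ hτ - (e 1 τ - e 2 τ) * hφe
      simp only [hK]
      rw [hφT' τ hτ, hφT τ hτ, key]
      simp only [halfPeriodValue_add_one, s10, s11, s12]
      ring
    · intro τ hτ
      simp only [hK]
      rw [hφS' τ hτ, hφS τ hτ]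
      simp only [halfPeriodValue_inv _ hτ.ne', s00, s01, s02]
      rw [show ((4 : ℤ)) = ((4 : ℕ) : ℤ) from rfl, zpow_natCast]
      ring
    -- At the cusp `φ` and `φ'` tend to `0`, as derivatives of a periodic function over its nonzero
    -- limit, and so does `e₁ - e₂`.
    · have e02 : Tendsto (fun τ => e 0 τ - e 2 τ) I∞ (𝓝 (2 * A - -A)) := h0.sub h2
      have hA3 : 2 * A - -A ≠ 0 := by
        have : 2 * A - -A = 3 * A := by ring
        rw [this]
        exact mul_ne_zero three_ne_zero hA
      set d : ℂ → ℂ := fun τ => e 0 τ - e 2 τ with hdd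
      have hdp : Function.Periodic d 2 := fun τ => by
        simp only [hdd, (periodic_halfPeriodValue _) τ]
      have hdD : DifferentiableOn ℂ d {τ : ℂ | 0 < τ.im} := (hd 0).sub (hd 2)
      have hdA (f : ℂ → ℂ) (hf : DifferentiableOn ℂ f {τ : ℂ | 0 < τ.im}) :
          ∀ᶠ z in I∞, DifferentiableAt ℂ f z := by
        filter_upwards [eventually_im_gt 0] with τ hτ
        exact hf.differentiableAt (isOpen_im_pos.mem_nhds hτ)
      have l1 := tendsto_deriv_of_periodic hdp (hdA d hdD) (e02.isBigO_one ℝ)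
      have hdp' : Function.Periodic (deriv d) 2 := fun τ => by
        rw [← deriv_comp_add_const]
        congr 1
        exact funext hdp
      have l2 := tendsto_deriv_of_periodic hdp' (hdA _ (hdD.deriv isOpen_im_pos))
        (l1.isBigO_one ℝ)
      have hdφ : ∀ τ : ℂ, 0 < τ.im → φ τ = deriv d τ / d τ := by
        intro τ hτ
        rw [((hasDerivAt_halfPeriodValue 0 hτ).fun_sub (hasDerivAt_halfPeriodValue 2 hτ)).deriv]
      have hdφ' : ∀ τ : ℂ, 0 < τ.im →
          deriv φ τ = deriv (deriv d) τ / d τ - (deriv d τ / d τ) ^ 2 := by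
        intro τ hτ
        have g3 : φ =ᶠ[𝓝 τ] fun z => deriv d z / d z := by
          filter_upwards [eventually_im_pos hτ] with z hz using hdφ z hz
        have a3 : d τ ≠ 0 := hne n02 hτ
        have g5 := ((hdD.deriv isOpen_im_pos).differentiableAt
          (isOpen_im_pos.mem_nhds hτ)).hasDerivAt.fun_div
          (hdD.differentiableAt (isOpen_im_pos.mem_nhds hτ)).hasDerivAt a3
        rw [g3.deriv_eq, g5.deriv]
        field_simp
      have lim := (((l2.div e02 hA3).sub ((l1.div e02 hA3).pow 2)).sub
        (((l1.div e02 hA3).pow 2).div_const 2)).sub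
        (((h0.sub h1).mul (h1.sub h2)).const_mul (c ^ 2 / 2))
      have hz : 0 / (2 * A - -A) - (0 / (2 * A - -A)) ^ 2 - (0 / (2 * A - -A)) ^ 2 / 2 -
          c ^ 2 / 2 * ((2 * A - -A) * (-A - -A)) = 0 := by
        ring
      rw [hz] at lim
      refine lim.congr' ?_
      filter_upwards [eventually_im_gt 0] with τ hτ
      simp only [hK]
      rw [hdφ' τ hτ, hdφ τ hτ]
      rfl
  intro τ hτ
  refine (hφ' τ hτ).congr_deriv ?_
  have h := hKz τ hτ
  simp only [hK] at h
  linear_combination h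

theorem hasDerivAt_modularLambda {c : ℂ} {τ : ℂ} (hτ : 0 < τ.im)
    (hc : (deriv (e 1) τ - deriv (e 2) τ) * (e 0 τ - e 1 τ) -
      (deriv (e 0) τ - deriv (e 1) τ) * (e 1 τ - e 2 τ) =
    c * ((e 1 τ - e 2 τ) * (e 0 τ - e 1 τ) * (e 0 τ - e 2 τ))) :
    HasDerivAt modularLambda
      (c * modularLambda τ * (1 - modularLambda τ) * (e 0 τ - e 2 τ)) τ := by
  have h1 : e 0 τ - e 2 τ ≠ 0 := halfPeriodValue_sub_ne_zero hτ.ne' (by decide)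
  have h := ((hasDerivAt_halfPeriodValue 1 hτ).fun_sub (hasDerivAt_halfPeriodValue 2 hτ)).fun_div
    ((hasDerivAt_halfPeriodValue 0 hτ).fun_sub (hasDerivAt_halfPeriodValue 2 hτ)) h1
  refine h.congr_deriv ?_
  rw [modularLambda]
  field_simp
  linear_combination hc

end Halphen

/-! ### Even covering from local sections of uniform size. -/

section CoveringCriterion

open Metric

/-- A point is evenly covered by a locally injective map as soon as the nearby points of the source
are values of local sections whose domains of definition are uniformly large. -/
theorem isEvenlyCovered_of_uniform_sections {E : Type*} [TopologicalSpace E] [T2Space E]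
    {f : E → ℂ} (hf : Continuous f) (hinj : IsLocallyInjective f) {y : ℂ} {ε : ℝ} (hε : 0 < ε)
    (h : ∀ x : E, f x ∈ ball y ε → ∃ s : ℂ → E, ContinuousOn s (ball (f x) (2 * ε)) ∧
      s (f x) = x ∧ ∀ z ∈ ball (f x) (2 * ε), f (s z) = z) :
    IsEvenlyCovered f y (f ⁻¹' {y}) := by
  choose! s hsc hsx hsf using h
  have hsub : ∀ x, f x ∈ ball y ε → ball y ε ⊆ ball (f x) (2 * ε) := fun x hx z hz => by
    rw [mem_ball] at *
    linarith [dist_triangle_right z (f x) y]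
  have hy : y ∈ ball y ε := mem_ball_self hε
  have hsf' : ∀ x, f x ∈ ball y ε → ∀ z ∈ ball y ε, f (s x z) = z := fun x hx z hz =>
    hsf x hx z (hsub x hx hz)
  -- Radius `2ε` makes every section defined on the whole of `ball y ε`, where two sections that
  -- agree once agree everywhere.
  have key : ∀ x x', f x ∈ ball y ε → f x' ∈ ball y ε → ∀ z ∈ ball y ε, s x z = s x' z →
      EqOn (s x) (s x') (ball y ε) := fun x x' hx hx' z hz hzz =>
    (T2Space.isSeparatedMap f).eqOn_of_comp_eqOn hinj (convex_ball y ε).isPreconnected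
      ((hsc x hx).mono (hsub x hx)) ((hsc x' hx').mono (hsub x' hx'))
      (fun w hw => by simp [hsf' x hx w hw, hsf' x' hx' w hw]) hz hzz
  have hyf : ∀ p : f ⁻¹' {y}, f p ∈ ball y ε := fun p => by rw [show f p = y from p.2]; exact hy
  have hdisc : DiscreteTopology (f ⁻¹' {y}) := by
    rw [discreteTopology_iff_isOpen_singleton]
    intro p
    obtain ⟨U, hU, hpU, hUi⟩ := hinj p
    have : ({p} : Set (f ⁻¹' {y})) = Subtype.val ⁻¹' U := by
      ext q
      refine ⟨fun hq => ?_, fun hq => ?_⟩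
      · rw [mem_singleton_iff.mp hq]; exact hpU
      · exact Subtype.ext (hUi hq hpU ((show f q = y from q.2).trans (show f p = y from p.2).symm))
    rw [this]
    exact hU.preimage continuous_subtype_val
  -- The sheet of `x` is labelled by the point where the section through `x` meets the fibre over
  -- `y`.
  refine ⟨hdisc, ball y ε, hy, isOpen_ball, isOpen_ball.preimage hf,
    { toFun := fun x => (⟨f x, x.2⟩, ⟨s x y, hsf' x x.2 y hy⟩)
      invFun := fun q => ⟨s q.2 q.1, by
        rw [mem_preimage, hsf' q.2 (hyf q.2) _ q.1.2]; exact q.1.2⟩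
      left_inv := fun x => Subtype.ext ?_
      right_inv := fun q => Prod.ext (Subtype.ext ?_) (Subtype.ext ?_)
      continuous_toFun := ?_
      continuous_invFun := ?_ }, fun x => rfl⟩
  · have h1 : f (s x y) = y := hsf' x x.2 y hy
    have h2 : f (s x y) ∈ ball y ε := by rw [h1]; exact hy
    have h3 : s (s x y) y = s x y := by
      have := hsx _ h2
      rwa [h1] at this
    exact (key _ _ h2 x.2 y hy h3 x.2).trans (hsx _ x.2)
  · exact hsf' q.2 (hyf q.2) _ q.1.2
  · have h1 : f (s q.2 q.1) = q.1 := hsf' q.2 (hyf q.2) _ q.1.2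
    have h2 : f (s q.2 q.1) ∈ ball y ε := by rw [h1]; exact q.1.2
    have h3 : s (s q.2 q.1) q.1 = s q.2 q.1 := by
      have := hsx _ h2
      rwa [h1] at this
    have h4 := hsx _ (hyf q.2)
    rw [show f q.2 = y from q.2.2] at h4
    exact (key _ _ h2 (hyf q.2) _ q.1.2 h3 hy).trans h4
  · have hfc : Continuous fun x : f ⁻¹' ball y ε => (⟨f x, x.2⟩ : ball y ε) :=
      (hf.comp continuous_subtype_val).subtype_mk _
    refine hfc.prodMk (Continuous.subtype_mk (continuous_iff_continuousAt.mpr fun x => ?_) _)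
    have h1 : Continuous fun a : f ⁻¹' ball y ε => s x (f a) :=
      ((hsc x x.2).mono (hsub x x.2)).comp_continuous (hf.comp continuous_subtype_val) fun a => a.2
    have h2 := hinj.isOpen_eqLocus h1 continuous_subtype_val
      (funext fun a => by simp [hsf' x x.2 _ a.2])
    have h3 : (fun a : f ⁻¹' ball y ε => s a y) =ᶠ[𝓝 x] fun _ => s x y := by
      filter_upwards [h2.mem_nhds (hsx _ x.2)] with a ha
      exact (key x a x.2 a.2 (f a) a.2 (ha.trans (hsx _ a.2).symm) hy).symm
    exact continuousAt_const.congr h3.symm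
  · refine Continuous.subtype_mk (continuous_prod_of_discrete_right.mpr fun p => ?_) _
    exact ((hsc p (hyf p)).mono (hsub p (hyf p))).comp_continuous continuous_subtype_val
      fun a => a.2

/-- Near a compact set, a local homeomorphism has local sections with uniformly large domains. -/
theorem IsLocalHomeomorph.exists_uniform_sections {E : Type*} [TopologicalSpace E] {f : E → ℂ}
    (hf : IsLocalHomeomorph f) {K : Set E} (hK : IsCompact K) :
    ∃ ε > 0, ∀ x ∈ K, ∃ s : ℂ → E, ContinuousOn s (ball (f x) ε) ∧
      s (f x) = x ∧ ∀ z ∈ ball (f x) ε, f (s z) = z := by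
  refine hK.induction_on (p := fun K => ∃ ε > 0, ∀ x ∈ K, ∃ s : ℂ → E,
    ContinuousOn s (ball (f x) ε) ∧ s (f x) = x ∧ ∀ z ∈ ball (f x) ε, f (s z) = z)
    ⟨1, one_pos, by simp⟩ (fun A B hAB ⟨ε, hε, h⟩ => ⟨ε, hε, fun x hx => h x (hAB hx)⟩) ?_ ?_
  · rintro A B ⟨ε, hε, h⟩ ⟨δ, hδ, h'⟩
    refine ⟨min ε δ, lt_min hε hδ, fun x hx => ?_⟩
    rcases hx with hx | hx
    · obtain ⟨s, h1, h2, h3⟩ := h x hx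
      have := ball_subset_ball (x := f x) (min_le_left ε δ)
      exact ⟨s, h1.mono this, h2, fun z hz => h3 z (this hz)⟩
    · obtain ⟨s, h1, h2, h3⟩ := h' x hx
      have := ball_subset_ball (x := f x) (min_le_right ε δ)
      exact ⟨s, h1.mono this, h2, fun z hz => h3 z (this hz)⟩
  · intro x hx
    obtain ⟨φ, hxφ, rfl⟩ := hf x
    obtain ⟨δ, hδ, hball⟩ := isOpen_iff.mp φ.open_target _ (φ.map_source hxφ)
    refine ⟨φ.source ∩ φ ⁻¹' ball (φ x) (δ / 2), mem_nhdsWithin_of_mem_nhds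
      ((φ.continuousOn.isOpen_inter_preimage φ.open_source isOpen_ball).mem_nhds
        ⟨hxφ, mem_ball_self (half_pos hδ)⟩), δ / 2, half_pos hδ, fun w hw => ?_⟩
    have hsub : ball (φ w) (δ / 2) ⊆ φ.target := by
      refine subset_trans (fun z hz => ?_) hball
      have h1 : φ w ∈ ball (φ x) (δ / 2) := hw.2
      rw [mem_ball] at *
      linarith [dist_triangle z (φ w) (φ x)]
    exact ⟨φ.symm, φ.continuousOn_symm.mono hsub, φ.left_inv hw.1,
      fun z hz => φ.right_inv (hsub hz)⟩

end CoveringCriterion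

/-! ### The modular lambda function is a covering. -/

section ModularLambdaCovering

local notation "e" => halfPeriodValue
local notation "I∞" => comap im atTop

open UpperHalfPlane in
/-- A modular substitution permutes the half-period values, up to a common factor. -/
theorem exists_perm_halfPeriodValue_smul (γ : Matrix.SpecialLinearGroup (Fin 2) ℤ) :
    ∃ π : Equiv.Perm (Fin 3), ∀ τ : ℍ, ∃ d : ℂ, d ≠ 0 ∧ ∀ i, e i ↑(γ • τ) = d * e (π i) τ := by
  have hγ : γ ∈ Subgroup.closure {ModularGroup.S, ModularGroup.T} := by
    simp [SpecialLinearGroup.SL2Z_generators]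
  induction hγ using Subgroup.closure_induction with
  | mem γ h =>
    rcases h with rfl | rfl
    · refine ⟨Equiv.swap 0 2, fun τ => ⟨(τ : ℂ) ^ 2, pow_ne_zero 2 τ.ne_zero, fun i => ?_⟩⟩
      rw [modular_S_smul, ← halfPeriodValue_inv i τ.im_ne_zero]
      congr 1
      change (-(τ : ℂ))⁻¹ = _
      rw [inv_neg, neg_div, one_div]
    · refine ⟨Equiv.swap 1 2, fun τ => ⟨1, one_ne_zero, fun i => ?_⟩⟩
      rw [modular_T_smul, one_mul, ← halfPeriodValue_add_one i τ]
      congr 1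
      rw [coe_vadd, add_comm]
      simp
  | one => exact ⟨1, fun τ => ⟨1, one_ne_zero, fun i => by simp⟩⟩
  | mul γ γ' _ _ h h' =>
    obtain ⟨π, hπ⟩ := h
    obtain ⟨π', hπ'⟩ := h'
    refine ⟨π' * π, fun τ => ?_⟩
    obtain ⟨d, hd, h1⟩ := hπ (γ' • τ)
    obtain ⟨d', hd', h2⟩ := hπ' τ
    refine ⟨d * d', mul_ne_zero hd hd', fun i => ?_⟩
    rw [mul_smul, h1, h2, mul_assoc, Equiv.Perm.mul_apply]
  | inv γ _ h =>
    obtain ⟨π, hπ⟩ := h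
    refine ⟨π⁻¹, fun τ => ?_⟩
    obtain ⟨d, hd, h1⟩ := hπ (γ⁻¹ • τ)
    refine ⟨d⁻¹, inv_ne_zero hd, fun i => ?_⟩
    have := h1 (π⁻¹ i)
    rw [smul_inv_smul, show π (π⁻¹ i) = i from π.apply_symm_apply i] at this
    rw [this, inv_mul_cancel_left₀ hd]

open UpperHalfPlane in
theorem exists_perm_modularLambda_smul (γ : Matrix.SpecialLinearGroup (Fin 2) ℤ) :
    ∃ π : Equiv.Perm (Fin 3), ∀ τ : ℍ, modularLambda ↑(γ • τ) =
      (e (π 1) τ - e (π 2) τ) / (e (π 0) τ - e (π 2) τ) := by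
  obtain ⟨π, hπ⟩ := exists_perm_halfPeriodValue_smul γ
  refine ⟨π, fun τ => ?_⟩
  obtain ⟨d, hd, h⟩ := hπ τ
  rw [modularLambda, h, h, h, ← mul_sub, ← mul_sub, mul_div_mul_left _ _ hd]

/-- Near the cusp, the modular lambda function and its transforms stay away from any compact set
of finite values different from `0` and `1`. -/
theorem eventually_lt_norm_lambda_sub {y : ℂ} {r : ℝ} (h0 : r < ‖y‖) (h1 : r < ‖1 - y‖)
    (π : Equiv.Perm (Fin 3)) :
    ∀ᶠ τ in I∞, r < ‖(e (π 1) τ - e (π 2) τ) / (e (π 0) τ - e (π 2) τ) - y‖ := by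
  obtain ⟨A, hA, l0, l1, l2⟩ := exists_tendsto_halfPeriodValue
  have hlim : ∀ i, Tendsto (e i) I∞ (𝓝 ((![2 * A, -A, -A] : Fin 3 → ℂ) i)) := by
    intro i
    fin_cases i
    exacts [l0, l1, l2]
  set a : Fin 3 → ℂ := ![2 * A, -A, -A] with ha
  -- The inequality is cleared of denominators because `e (π 0) - e (π 2)` may tend to `0`. The
  -- limit of the quotient is `0`, `∞` or `1`, according to the index that `π` sends to `0`.
  have hN : Tendsto (fun τ => ‖(e (π 1) τ - e (π 2) τ) - y * (e (π 0) τ - e (π 2) τ)‖ -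
      r * ‖e (π 0) τ - e (π 2) τ‖) I∞ (𝓝 (‖(a (π 1) - a (π 2)) - y * (a (π 0) - a (π 2))‖ -
      r * ‖a (π 0) - a (π 2)‖)) :=
    ((((hlim _).sub (hlim _)).sub (((hlim _).sub (hlim _)).const_mul y)).norm).sub
      (((hlim _).sub (hlim _)).norm.const_mul r)
  have hA3 : 0 < ‖3 * A‖ := norm_pos_iff.mpr (mul_ne_zero three_ne_zero hA)
  have hpos : 0 < ‖(a (π 1) - a (π 2)) - y * (a (π 0) - a (π 2))‖ - r * ‖a (π 0) - a (π 2)‖ := by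
    have ha0 : a 0 = 2 * A := rfl
    have hak : ∀ k, k ≠ 0 → a k = -A := by
      intro k hk
      fin_cases k
      exacts [absurd rfl hk, rfl, rfl]
    obtain ⟨j, hj⟩ := π.surjective 0
    have hother : ∀ k, k ≠ j → a (π k) = -A := fun k hk =>
      hak _ fun h => hk (π.injective (h.trans hj.symm))
    fin_cases j
    · have b0 : a (π 0) = 2 * A := (congrArg a hj).trans ha0
      rw [hother 1 (by decide), hother 2 (by decide), b0,
        show -A - -A - y * (2 * A - -A) = -(y * (3 * A)) by ring,
        show 2 * A - -A = 3 * A by ring, norm_neg, norm_mul, ← sub_mul]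
      exact mul_pos (sub_pos.mpr h0) hA3
    · have b0 : a (π 1) = 2 * A := (congrArg a hj).trans ha0
      rw [hother 0 (by decide), hother 2 (by decide), b0,
        show 2 * A - -A - y * (-A - -A) = 3 * A by ring,
        show -A - -A = 0 by ring, norm_zero, mul_zero, sub_zero]
      exact hA3
    · have b0 : a (π 2) = 2 * A := (congrArg a hj).trans ha0
      rw [hother 0 (by decide), hother 1 (by decide), b0,
        show -A - 2 * A - y * (-A - 2 * A) = -((1 - y) * (3 * A)) by ring,
        show -A - 2 * A = -(3 * A) by ring, norm_neg, norm_neg, norm_mul, ← sub_mul]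
      exact mul_pos (sub_pos.mpr h1) hA3
  filter_upwards [hN.eventually (lt_mem_nhds hpos), eventually_im_gt 0] with τ hτ him
  have hd : e (π 0) τ - e (π 2) τ ≠ 0 :=
    halfPeriodValue_sub_ne_zero him.ne' (π.injective.ne (by decide))
  have heq : (e (π 1) τ - e (π 2) τ) / (e (π 0) τ - e (π 2) τ) - y =
      ((e (π 1) τ - e (π 2) τ) - y * (e (π 0) τ - e (π 2) τ)) / (e (π 0) τ - e (π 2) τ) := by
    field_simp
  rw [heq, norm_div, lt_div_iff₀ (norm_pos_iff.mpr hd)]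
  linarith

/-- The modular lambda function has a non-vanishing derivative. -/
theorem exists_hasStrictDerivAt_modularLambda {τ : ℂ} (hτ : 0 < τ.im) :
    ∃ l : ℂ, l ≠ 0 ∧ HasStrictDerivAt modularLambda l τ := by
  obtain ⟨c, hc, hrel⟩ := exists_wronskian_eq
  have hd : DifferentiableOn ℂ modularLambda {τ : ℂ | 0 < τ.im} := fun z hz =>
    (hasDerivAt_modularLambda hz (hrel z hz)).differentiableAt.differentiableWithinAt
  have h := ((hd.analyticAt (isOpen_im_pos.mem_nhds hτ)).hasStrictDerivAt)
  rw [(hasDerivAt_modularLambda hτ (hrel τ hτ)).deriv] at h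
  refine ⟨_, ?_, h⟩
  exact mul_ne_zero (mul_ne_zero (mul_ne_zero hc (modularLambda_ne_zero hτ.ne'))
    (sub_ne_zero.mpr (modularLambda_ne_one hτ.ne').symm))
    (halfPeriodValue_sub_ne_zero hτ.ne' (by decide))

open UpperHalfPlane in
theorem isLocalHomeomorph_modularLambda : IsLocalHomeomorph fun τ : ℍ => modularLambda τ := by
  have h1 : IsLocalHomeomorphOn modularLambda {τ : ℂ | 0 < τ.im} := by
    refine IsLocalHomeomorphOn.mk _ _ fun τ hτ => ?_
    obtain ⟨l, hl, h⟩ := exists_hasStrictDerivAt_modularLambda hτ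
    have h' := h.hasStrictFDerivAt_equiv hl
    exact ⟨h'.toOpenPartialHomeomorph, h'.mem_toOpenPartialHomeomorph_source, fun _ _ => rfl⟩
  have h2 := h1.comp (isLocalHomeomorph_iff_isLocalHomeomorphOn_univ.mp
    isOpenEmbedding_coe.isLocalHomeomorph) fun τ _ => τ.coe_im_pos
  exact isLocalHomeomorph_iff_isLocalHomeomorphOn_univ.mpr h2

open UpperHalfPlane Metric in
/-- The modular lambda function is a covering of the plane without `0` and `1`. -/
theorem isCoveringMapOn_modularLambda :
    IsCoveringMapOn (fun τ : ℍ => modularLambda τ) {0, 1}ᶜ := by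
  intro y hy
  simp only [mem_compl_iff, mem_insert_iff, mem_singleton_iff, not_or] at hy
  have hloc := isLocalHomeomorph_modularLambda
  obtain ⟨r, hr, hr0, hr1⟩ : ∃ r : ℝ, 0 < r ∧ r < ‖y‖ ∧ r < ‖1 - y‖ := by
    obtain ⟨r, hr, hr'⟩ := exists_between (lt_min (norm_pos_iff.mpr hy.1)
      (norm_pos_iff.mpr (sub_ne_zero.mpr (Ne.symm hy.2))))
    exact ⟨r, hr, lt_min_iff.mp hr'⟩
  let L (π : Equiv.Perm (Fin 3)) (τ : ℂ) : ℂ :=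
    (e (π 1) τ - e (π 2) τ) / (e (π 0) τ - e (π 2) τ)
  obtain ⟨Y, hY⟩ : ∃ Y : ℝ, ∀ π, ∀ τ : ℂ, Y ≤ τ.im → r < ‖L π τ - y‖ := by
    have h := eventually_all.mpr (eventually_lt_norm_lambda_sub hr0 hr1)
    obtain ⟨V, hV, hsub⟩ := mem_comap.mp h
    obtain ⟨Y, hY⟩ := mem_atTop_sets.mp hV
    exact ⟨Y, fun π τ hτ => hsub (show τ ∈ Complex.im ⁻¹' V from hY _ hτ) π⟩
  have hK := ModularGroup.isCompact_truncatedFundamentalDomain Y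
  -- Each transform of `λ` is one of finitely many `L π`, so one `ε` serves all of them over the
  -- compact truncated fundamental domain.
  have hsec : ∀ π : Equiv.Perm (Fin 3), ∀ᶠ ε in 𝓝[>] (0 : ℝ), ∀ γ :
      Matrix.SpecialLinearGroup (Fin 2) ℤ, (∀ τ : ℍ, modularLambda ↑(γ • τ) = L π τ) →
      ∀ τ ∈ ModularGroup.truncatedFundamentalDomain Y, ∃ s : ℂ → ℍ,
        ContinuousOn s (ball (L π τ) (2 * ε)) ∧ s (L π τ) = τ ∧
        ∀ z ∈ ball (L π τ) (2 * ε), L π (s z) = z := by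
    intro π
    by_cases hγ : ∃ γ : Matrix.SpecialLinearGroup (Fin 2) ℤ, ∀ τ : ℍ,
        modularLambda ↑(γ • τ) = L π τ
    · obtain ⟨γ, hγ⟩ := hγ
      have hL : IsLocalHomeomorph fun τ : ℍ => L π τ := by
        have := hloc.comp (Homeomorph.smul (γ : GL (Fin 2) ℝ)).isLocalHomeomorph
        exact (funext hγ : (fun τ : ℍ => modularLambda ↑(γ • τ)) = _) ▸ this
      obtain ⟨ε, hε, h⟩ := hL.exists_uniform_sections hK
      filter_upwards [Ioo_mem_nhdsGT (half_pos hε)] with δ hδ _ _ τ hτ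
      obtain ⟨s, h1, h2, h3⟩ := h τ hτ
      have hsub : ball (L π τ) (2 * δ) ⊆ ball (L π τ) ε := ball_subset_ball (by linarith [hδ.2])
      exact ⟨s, h1.mono hsub, h2, fun z hz => h3 z (hsub hz)⟩
    · exact .of_forall fun ε γ h => absurd ⟨γ, h⟩ hγ
  obtain ⟨ε, hε, hε0, hεr⟩ := ((eventually_all.mpr hsec).and
    (Ioo_mem_nhdsGT hr)).exists
  refine isEvenlyCovered_of_uniform_sections hloc.continuous hloc.isLocallyInjective hε0
    fun x hx => ?_
  obtain ⟨γ, hγ⟩ := ModularGroup.exists_smul_mem_fd x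
  obtain ⟨π, hπ⟩ := exists_perm_modularLambda_smul γ⁻¹
  have hLx : L π ↑(γ • x) = modularLambda x := by
    have := hπ (γ • x)
    rw [inv_smul_smul] at this
    exact this.symm
  -- Above height `Y` every `L π` is farther than `r > ε` from `y`, so the representative of `x`
  -- lies in the truncated domain.
  have him : (γ • x).im ≤ Y := by
    by_contra! hcon
    have := hY π ↑(γ • x) hcon.le
    rw [hLx] at this
    rw [mem_ball, dist_eq_norm] at hx
    linarith
  obtain ⟨s, h1, h2, h3⟩ := hε π γ⁻¹ hπ _ ⟨hγ, him⟩
  rw [hLx] at h1 h2 h3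
  refine ⟨fun z => γ⁻¹ • s z, h1.const_smul ((γ⁻¹ : Matrix.SpecialLinearGroup (Fin 2) ℤ) : GL (Fin 2) ℝ), ?_, fun z hz => ?_⟩
  · change γ⁻¹ • s (modularLambda x) = x
    rw [h2, inv_smul_smul]
  · change modularLambda ↑(γ⁻¹ • s z) = z
    rw [hπ]
    exact h3 z hz

end ModularLambdaCovering

/-! ### Values of Burnside's function, branches of its inverse and of the product of roots. -/

section InverseBranch

open scoped UpperHalfPlane

local notation "e" => halfPeriodValue

/-- A holomorphic function is locally injective where its derivative does not vanish. -/
theorem isLocallyInjective_of_hasStrictDerivAt {f : ℂ → ℂ} {V : Set ℂ}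
    (h : ∀ x ∈ V, ∃ l : ℂ, l ≠ 0 ∧ HasStrictDerivAt f l x) :
    IsLocallyInjective fun x : V => f x := by
  intro x
  obtain ⟨l, hl, h⟩ := h x x.2
  have h' := h.hasStrictFDerivAt_equiv hl
  refine ⟨Subtype.val ⁻¹' h'.toOpenPartialHomeomorph.source,
    h'.toOpenPartialHomeomorph.open_source.preimage continuous_subtype_val,
    h'.mem_toOpenPartialHomeomorph_source, fun a ha b hb hab => Subtype.ext ?_⟩
  exact h'.toOpenPartialHomeomorph.injOn ha hb hab

/-- A continuous lift of a differentiable function through a holomorphic function with nonzero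
derivative is differentiable. -/
theorem DifferentiableAt.of_comp_hasStrictDerivAt {f t q : ℂ → ℂ} {l x : ℂ} (hl : l ≠ 0)
    (hf : HasStrictDerivAt f l (t x)) (ht : ContinuousAt t x) (hq : DifferentiableAt ℂ q x)
    (h : ∀ᶠ z in 𝓝 x, f (t z) = q z) : DifferentiableAt ℂ t x := by
  have hf' := hf.hasStrictFDerivAt_equiv hl
  have h1 : ∀ᶠ z in 𝓝 x, hf'.localInverse f _ _ (q z) = t z := by
    filter_upwards [ht.eventually hf'.eventually_left_inverse, h] with z h1 h2
    rw [← h2, h1]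
  have h2 : DifferentiableAt ℂ (hf'.localInverse f _ _) (q x) := by
    rw [← h.self_of_nhds]
    exact hf'.to_localInverse.differentiableAt
  exact (h2.comp x hq).congr_of_eventuallyEq (h1.mono fun z hz => hz.symm)

theorem factors_ne_zero {x : ℂ} (hx : x ^ 5 - x ≠ 0) : x ≠ 0 ∧ x ^ 2 - 1 ≠ 0 ∧ x ^ 2 + 1 ≠ 0 := by
  have : x ^ 5 - x = x * (x ^ 2 - 1) * (x ^ 2 + 1) := by ring
  rw [this] at hx
  exact ⟨left_ne_zero_of_mul (left_ne_zero_of_mul hx), right_ne_zero_of_mul (left_ne_zero_of_mul hx),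
    right_ne_zero_of_mul hx⟩

theorem hasDerivAt_burnsideCover {x : ℂ} (hx : x ^ 2 + 1 ≠ 0) :
    HasDerivAt burnsideCover (8 * x * (x ^ 2 - 1) / (x ^ 2 + 1) ^ 3) x := by
  have h := ((((hasDerivAt_pow 2 x).sub_const 1).fun_div ((hasDerivAt_pow 2 x).add_const 1)
    hx).fun_pow 2)
  refine h.congr_deriv ?_
  push_cast
  field_simp
  ring

theorem burnsideCover_ne {x : ℂ} (hx : x ^ 5 - x ≠ 0) : burnsideCover x ∈ ({0, 1} : Set ℂ)ᶜ := by
  obtain ⟨h0, h1, h2⟩ := factors_ne_zero hx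
  simp only [mem_compl_iff, mem_insert_iff, mem_singleton_iff, not_or]
  refine ⟨pow_ne_zero 2 (div_ne_zero h1 h2), fun h => ?_⟩
  rw [burnsideCover, div_pow, div_eq_one_iff_eq (pow_ne_zero 2 h2)] at h
  exact pow_ne_zero 2 h0 (by linear_combination (-1 / 4) * h)

theorem isOpen_factors : IsOpen {x : ℂ | x ^ 5 - x ≠ 0} :=
  isOpen_ne_fun (by fun_prop) continuous_const

theorem exists_hasStrictDerivAt_burnsideCover {x : ℂ} (hx : x ^ 5 - x ≠ 0) :
    ∃ l : ℂ, l ≠ 0 ∧ HasStrictDerivAt burnsideCover l x := by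
  obtain ⟨h0, h1, h2⟩ := factors_ne_zero hx
  have hd : DifferentiableOn ℂ burnsideCover {x : ℂ | x ^ 5 - x ≠ 0} := fun z hz =>
    (hasDerivAt_burnsideCover (factors_ne_zero hz).2.2).differentiableAt.differentiableWithinAt
  have h := (hd.analyticAt (isOpen_factors.mem_nhds hx)).hasStrictDerivAt
  rw [(hasDerivAt_burnsideCover h2).deriv] at h
  exact ⟨_, div_ne_zero (mul_ne_zero (mul_ne_zero (by norm_num) h0) h1) (pow_ne_zero 3 h2), h⟩

/-- Burnside's function has the unique lifting property on simply connected spaces. -/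
theorem exists_lift_burnsideX {A : Type*} [TopologicalSpace A] [SimplyConnectedSpace A]
    [LocallyPathConnectedSpace A] (f : C(A, ℂ)) (hf : ∀ a, f a ^ 5 - f a ≠ 0) {a₀ : A} {τ₀ : ℍ}
    (h₀ : burnsideX τ₀ = f a₀) :
    ∃ F : C(A, ℍ), F a₀ = τ₀ ∧ ∀ a, burnsideX (F a) = f a := by
  have hcont : ContinuousOn burnsideCover {x : ℂ | x ^ 5 - x ≠ 0} := fun z hz =>
    (hasDerivAt_burnsideCover (factors_ne_zero hz).2.2).continuousAt.continuousWithinAt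
  let g : C(A, ℂ) := ⟨fun a => burnsideCover (f a), hcont.comp_continuous f.continuous hf⟩
  obtain ⟨F, ⟨hF0, hF⟩, -⟩ := isCoveringMapOn_modularLambda.existsUnique_continuousMap_lifts g
    (a₀ := a₀) (e₀ := τ₀) (by
      change modularLambda τ₀ = burnsideCover (f a₀)
      rw [← h₀, (burnsideX_spec τ₀.im_ne_zero).2.1]) fun a => burnsideCover_ne (hf a)
  refine ⟨F, hF0, fun a => ?_⟩
  -- Both `burnsideX ∘ F` and `f` lift the same map through the locally injective `burnsideCover`,
  -- and they agree at `a₀`.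
  let V : Set ℂ := {x : ℂ | x ^ 5 - x ≠ 0}
  let g₁ : A → V := fun a => ⟨burnsideX (F a), (burnsideX_spec (F a).im_ne_zero).1⟩
  let g₂ : A → V := fun a => ⟨f a, hf a⟩
  have hg₁ : Continuous g₁ := Continuous.subtype_mk (continuousOn_burnsideX.comp_continuous
    (UpperHalfPlane.continuous_coe.comp F.continuous) fun a => (F a).coe_im_pos) _
  have hg₂ : Continuous g₂ := f.continuous.subtype_mk _
  have := (T2Space.isSeparatedMap fun x : V => burnsideCover x).eq_of_comp_eq
    (isLocallyInjective_of_hasStrictDerivAt fun x hx => exists_hasStrictDerivAt_burnsideCover hx)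
    hg₁ hg₂ (funext fun a => ?_) a₀ (Subtype.ext ((congrArg (fun τ : ℍ => burnsideX τ) hF0).trans h₀))
  · exact congrArg Subtype.val (congrFun this a)
  · exact (burnsideX_spec (F a).im_ne_zero).2.1.trans (congrFun hF a)

theorem isPathConnected_factors : IsPathConnected {x : ℂ | x ^ 5 - x ≠ 0} := by
  have hfin : {x : ℂ | x ^ 5 - x = 0}.Countable := by
    let p : Polynomial ℂ := Polynomial.X ^ 5 - Polynomial.X
    have hp : p ≠ 0 := fun h => by
      have := congrArg (Polynomial.eval 2) h
      simp [p] at this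
      norm_num at this
    refine ((p.rootSet_finite ℂ).subset fun x hx => ?_).countable
    rw [Polynomial.mem_rootSet]
    exact ⟨hp, by simpa [p] using hx⟩
  exact hfin.isPathConnected_compl_of_one_lt_rank (by simp)

/-- Burnside's function takes all values except the zeros of `x⁵ - x`. -/
theorem ne_zero_iff_exists_burnsideX (x : ℂ) :
    x ^ 5 - x ≠ 0 ↔ ∃ τ : ℂ, τ.im ≠ 0 ∧ burnsideX τ = x := by
  refine ⟨fun hx => ?_, ?_⟩
  · have h0 := (burnsideX_spec UpperHalfPlane.I.im_ne_zero).1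
    obtain ⟨γ, hγ⟩ := isPathConnected_factors.joinedIn _ h0 x hx
    -- A path from a known value to `x` is lifted, extended to `ℝ` so that the source is simply
    -- connected and locally path connected.
    obtain ⟨F, -, hF⟩ := exists_lift_burnsideX (A := ℝ) ⟨γ.extend, γ.continuous_extend⟩
      (fun a => hγ _) (a₀ := 0) (τ₀ := UpperHalfPlane.I) γ.extend_zero.symm
    exact ⟨F 1, (F 1).im_ne_zero, (hF 1).trans γ.extend_one⟩
  · rintro ⟨τ, hτ, rfl⟩
    exact (burnsideX_spec hτ).1

theorem exists_hasStrictDerivAt_modularLambda_of_im_ne_zero {τ : ℂ} (hτ : τ.im ≠ 0) :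
    ∃ l : ℂ, l ≠ 0 ∧ HasStrictDerivAt modularLambda l τ := by
  rcases hτ.lt_or_gt with h | h
  · obtain ⟨l, hl, hd⟩ := exists_hasStrictDerivAt_modularLambda (τ := -τ) (by simpa using h)
    refine ⟨l * -1, mul_ne_zero hl (by norm_num), ?_⟩
    have h2 := hd.comp τ (hasStrictDerivAt_neg τ)
    rwa [show modularLambda ∘ Neg.neg = modularLambda from funext modularLambda_neg] at h2
  · exact exists_hasStrictDerivAt_modularLambda h

theorem IsInverseBranch.modularLambda_eq {U : Set ℂ} {t : ℂ → ℂ} (ht : IsInverseBranch U t) {x : ℂ}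
    (hx : x ∈ U) : modularLambda (t x) = burnsideCover x := by
  rw [← (burnsideX_spec (ht.im_ne x hx)).2.1, ht.inv x hx]

/-- A branch of the inverse of Burnside's function is determined by one of its values. -/
theorem IsInverseBranch.eqOn {U : Set ℂ} (hU : IsPreconnected U) {t t' : ℂ → ℂ}
    (ht : IsInverseBranch U t) (ht' : IsInverseBranch U t') {x₀ : ℂ} (hx₀ : x₀ ∈ U)
    (h : t x₀ = t' x₀) : EqOn t t' U := by
  let V : Set ℂ := {τ : ℂ | τ.im ≠ 0}
  let g₁ : U → V := fun x => ⟨t x, ht.im_ne x x.2⟩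
  let g₂ : U → V := fun x => ⟨t' x, ht'.im_ne x x.2⟩
  have hc : ∀ {s : ℂ → ℂ}, IsInverseBranch U s → Continuous fun x : U => s x := fun hs =>
    continuousOn_iff_continuous_domRestrict.mp hs.holo.continuousOn
  have : PreconnectedSpace U := isPreconnected_iff_preconnectedSpace.mp hU
  have key := (T2Space.isSeparatedMap fun τ : V => modularLambda τ).eq_of_comp_eq
    (isLocallyInjective_of_hasStrictDerivAt fun τ hτ =>
      exists_hasStrictDerivAt_modularLambda_of_im_ne_zero hτ)
    ((hc ht).subtype_mk _ : Continuous g₁) ((hc ht').subtype_mk _ : Continuous g₂)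
    (funext fun x => (ht.modularLambda_eq x.2).trans (ht'.modularLambda_eq x.2).symm)
    ⟨x₀, hx₀⟩ (Subtype.ext h)
  exact fun x hx => congrArg Subtype.val (congrFun key ⟨x, hx⟩)

/-- Burnside's function is even, so negation exchanges branches in the two half-planes. -/
theorem IsInverseBranch.neg {U : Set ℂ} {t : ℂ → ℂ} (ht : IsInverseBranch U t) :
    IsInverseBranch U fun x => -t x :=
  ⟨ht.holo.neg, fun x hx => by simpa using ht.im_ne x hx,
    fun x hx => by rw [burnsideX_neg, ht.inv x hx]⟩

theorem IsRootBranch.neg {U : Set ℂ} {t w : ℂ → ℂ} (h : IsRootBranch U t w) :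
    IsRootBranch U (fun x => -t x) w := by
  refine ⟨h.holo, fun x hx hx4 => ?_⟩
  obtain ⟨r, s, hr, hs, hw⟩ := h.root x hx hx4
  refine ⟨r, s, hr, ?_, hw⟩
  rw [hs, wp_neg_period, wp_neg]

theorem exists_isInverseBranch_of_im_pos {U : Set ℂ} (hU : IsOpen U) (hsc : IsSimplyConnected U)
    (hS : ∀ x ∈ U, x ^ 5 - x ≠ 0) {x₀ τ₀ : ℂ} (hx₀ : x₀ ∈ U) (hτ₀ : 0 < τ₀.im)
    (h₀ : burnsideX τ₀ = x₀) :
    ∃ t : ℂ → ℂ, IsInverseBranch U t ∧ t x₀ = τ₀ ∧ ∀ x ∈ U, 0 < (t x).im := by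
  classical
  have := hsc.simplyConnectedSpace
  have := hU.locallyPathConnectedSpace
  obtain ⟨F, hF0, hF⟩ := exists_lift_burnsideX (A := U) ⟨fun x => (x : ℂ), continuous_subtype_val⟩
    (fun x => hS x x.2) (a₀ := ⟨x₀, hx₀⟩) (τ₀ := ⟨τ₀, hτ₀⟩) h₀
  let t : ℂ → ℂ := fun x => if h : x ∈ U then F ⟨x, h⟩ else 0
  have htF : ∀ x : U, t x = F x := fun x => dif_pos x.2
  have htc : ContinuousOn t U := by
    rw [continuousOn_iff_continuous_domRestrict]
    exact (UpperHalfPlane.continuous_coe.comp F.continuous).congr fun x => (htF x).symm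
  have him : ∀ x ∈ U, 0 < (t x).im := fun x hx => by
    rw [htF ⟨x, hx⟩]
    exact (F ⟨x, hx⟩).coe_im_pos
  have hinv : ∀ x ∈ U, burnsideX (t x) = x := fun x hx => by
    rw [htF ⟨x, hx⟩]
    exact hF ⟨x, hx⟩
  refine ⟨t, ⟨fun x hx => ?_, fun x hx => (him x hx).ne', hinv⟩, ?_, him⟩
  -- The lift is so far only continuous; `λ ∘ t = burnsideCover` with `λ' ≠ 0` makes it holomorphic.
  · obtain ⟨l, hl, hd⟩ := exists_hasStrictDerivAt_modularLambda (him x hx)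
    refine (DifferentiableAt.of_comp_hasStrictDerivAt hl hd (htc.continuousAt (hU.mem_nhds hx))
      (hasDerivAt_burnsideCover (factors_ne_zero (hS x hx)).2.2).differentiableAt
      ?_).differentiableWithinAt
    filter_upwards [hU.mem_nhds hx] with z hz
    rw [← (burnsideX_spec (him z hz).ne').2.1, hinv z hz]
  · rw [htF ⟨x₀, hx₀⟩, hF0]

/-- The square of a branch of the product of roots, as an expression in the half-period values. -/
theorem root_product_eq {x τ : ℂ} (hτ : τ.im ≠ 0) (hx : burnsideX τ = x) (hx4 : x ^ 4 ≠ 5) :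
    (x ^ 5 - x) / (x ^ 4 - 5) * wp τ 2 (2 * τ) =
      (e 0 τ - e 2 τ) * (x * (x ^ 2 - 1)) / (3 * (x ^ 2 + 1)) := by
  have h := (burnsideX_spec hτ).2.2.1
  have hS := (burnsideX_spec hτ).1
  rw [hx] at h hS
  have h2 := (factors_ne_zero hS).2.2
  have h5 : x ^ 4 - 5 ≠ 0 := sub_ne_zero.mpr hx4
  field_simp
  refine mul_right_cancel₀ h2 ?_
  linear_combination (x ^ 5 - x) * h

theorem exists_isRootBranch_of_im_pos {U : Set ℂ} (hU : IsOpen U) (hsc : IsSimplyConnected U)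
    (hS : ∀ x ∈ U, x ^ 5 - x ≠ 0) {t : ℂ → ℂ} (ht : IsInverseBranch U t)
    (him : ∀ x ∈ U, 0 < (t x).im) : ∃ w : ℂ → ℂ, IsRootBranch U t w := by
  -- The product of the radicands in the form that is holomorphic and nonvanishing on all of `U`,
  -- the points with `x⁴ = 5` included.
  set g : ℂ → ℂ := fun x => (e 0 (t x) - e 2 (t x)) * (x * (x ^ 2 - 1)) / (3 * (x ^ 2 + 1)) with hg
  have hgd : ∀ x ∈ U, DifferentiableAt ℂ g x := fun x hx => by
    have h1 : ∀ i, DifferentiableAt ℂ (fun x => e i (t x)) x := fun i =>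
      (hasDerivAt_halfPeriodValue i (him x hx)).differentiableAt.comp x
        (ht.holo.differentiableAt (hU.mem_nhds hx))
    have h2 := (factors_ne_zero (hS x hx)).2.2
    exact (((h1 0).sub (h1 2)).mul (by fun_prop)).div (by fun_prop)
      (mul_ne_zero three_ne_zero h2)
  have hg0 : ∀ x ∈ U, g x ≠ 0 := fun x hx => by
    obtain ⟨h0, h1, h2⟩ := factors_ne_zero (hS x hx)
    exact div_ne_zero (mul_ne_zero (halfPeriodValue_sub_ne_zero (him x hx).ne' (by decide))
      (mul_ne_zero h0 h1)) (mul_ne_zero three_ne_zero h2)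
  obtain ⟨w, hwc, hw⟩ := Complex.exists_continuousOn_pow_eq hsc hU
    (fun x hx => (hgd x hx).continuousAt.continuousWithinAt)
    (by rintro ⟨x, hx, h⟩; exact hg0 x hx h) two_ne_zero
  refine ⟨w, fun x hx => ?_, fun x hx hx4 => ?_⟩
  · have hw0 : w x ≠ 0 := fun h => hg0 x hx (by rw [← hw x, h]; simp)
    have hd : HasStrictDerivAt (fun z : ℂ => z ^ 2) (2 * w x) (w x) := by
      simpa using hasStrictDerivAt_pow 2 (w x)
    exact (DifferentiableAt.of_comp_hasStrictDerivAt (mul_ne_zero two_ne_zero hw0) hd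
      (hwc.continuousAt (hU.mem_nhds hx)) (hgd x hx) (.of_forall hw)).differentiableWithinAt
  · obtain ⟨r, hr⟩ := IsAlgClosed.exists_pow_nat_eq ((x ^ 5 - x) / (x ^ 4 - 5)) two_pos
    have hr0 : r ≠ 0 := by
      rintro rfl
      exact div_ne_zero (hS x hx) (sub_ne_zero.mpr hx4) (by rw [← hr]; simp)
    refine ⟨r, w x / r, hr, ?_, by field_simp⟩
    rw [div_pow, div_eq_iff (pow_ne_zero 2 hr0), hr, hw x, mul_comm,
      root_product_eq (ht.im_ne x hx) (ht.inv x hx) hx4]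

theorem exists_branches {U : Set ℂ} (hU : IsOpen U) (hsc : IsSimplyConnected U)
    (hS : ∀ x ∈ U, x ^ 5 - x ≠ 0) {x₀ τ₀ : ℂ} (hx₀ : x₀ ∈ U) (hτ₀ : τ₀.im ≠ 0)
    (h₀ : burnsideX τ₀ = x₀) :
    ∃ t : ℂ → ℂ, IsInverseBranch U t ∧ t x₀ = τ₀ ∧ ∃ w : ℂ → ℂ, IsRootBranch U t w := by
  rcases hτ₀.lt_or_gt with h | h
  · obtain ⟨t, ht, ht0, him⟩ := exists_isInverseBranch_of_im_pos (τ₀ := -τ₀) hU hsc hS hx₀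
      (by simpa using h) (by rw [burnsideX_neg, h₀])
    obtain ⟨w, hw⟩ := exists_isRootBranch_of_im_pos hU hsc hS ht him
    exact ⟨_, ht.neg, by rw [ht0, neg_neg], w, hw.neg⟩
  · obtain ⟨t, ht, ht0, him⟩ := exists_isInverseBranch_of_im_pos hU hsc hS hx₀ h h₀
    exact ⟨t, ht, ht0, exists_isRootBranch_of_im_pos hU hsc hS ht him⟩

end InverseBranch

/-! ### Reduction of order for a second-order linear equation. -/

section ReductionOfOrder

/-- Reduction of order: if `w` solves `y'' = Q y` and `2 w' t' + w t'' = 0`, where neither `w` nor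
`t'` vanishes, then `w` and `w t` form a basis of the solutions. -/
theorem reduction_of_order {U : Set ℂ} (hU : IsOpen U) (hUc : IsConnected U)
    {Q w w' t t' t'' : ℂ → ℂ} (hw : ∀ x ∈ U, HasDerivAt w (w' x) x)
    (hw' : ∀ x ∈ U, HasDerivAt w' (Q x * w x) x) (ht : ∀ x ∈ U, HasDerivAt t (t' x) x)
    (ht' : ∀ x ∈ U, HasDerivAt t' (t'' x) x) (hwt : ∀ x ∈ U, 2 * w' x * t' x + w x * t'' x = 0)
    (hw0 : ∀ x ∈ U, w x ≠ 0) (ht0 : ∀ x ∈ U, t' x ≠ 0) :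
    (∀ A B : ℂ, DifferentiableOn ℂ (fun x => w x * (A * t x + B)) U ∧ ∀ x ∈ U,
      deriv (deriv fun x => w x * (A * t x + B)) x = Q x * (w x * (A * t x + B))) ∧
    ∀ Ψ : ℂ → ℂ, DifferentiableOn ℂ Ψ U → (∀ x ∈ U, deriv (deriv Ψ) x = Q x * Ψ x) →
      ∃! c : ℂ × ℂ, ∀ x ∈ U, Ψ x = w x * (c.1 * t x + c.2) := by
  have hconst : ∀ f : ℂ → ℂ, (∀ x ∈ U, HasDerivAt f 0 x) → ∃ a, ∀ x ∈ U, f x = a := fun f hf =>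
    hU.exists_is_const_of_deriv_eq_zero hUc.isPreconnected
      (fun x hx => (hf x hx).differentiableAt.differentiableWithinAt) fun x hx => (hf x hx).deriv
  obtain ⟨x₀, hx₀⟩ := hUc.nonempty
  refine ⟨fun A B => ?_, fun Ψ hΨ hode => ?_⟩
  · have h1 : ∀ x ∈ U, HasDerivAt (fun x => w x * (A * t x + B))
        (w' x * (A * t x + B) + w x * (A * t' x)) x := fun x hx =>
      (hw x hx).fun_mul (((ht x hx).const_mul A).add_const B)
    refine ⟨fun x hx => (h1 x hx).differentiableAt.differentiableWithinAt, fun x hx => ?_⟩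
    have h2 : deriv (fun x => w x * (A * t x + B)) =ᶠ[𝓝 x]
        fun x => w' x * (A * t x + B) + w x * (A * t' x) := by
      filter_upwards [hU.mem_nhds hx] with z hz using (h1 z hz).deriv
    have h3 := ((hw' x hx).fun_mul (((ht x hx).const_mul A).add_const B)).fun_add
      ((hw x hx).fun_mul ((ht' x hx).const_mul A))
    rw [h2.deriv_eq, h3.deriv]
    linear_combination A * hwt x hx
  · have hΨ1 : ∀ x ∈ U, HasDerivAt Ψ (deriv Ψ x) x := fun x hx =>
      (hΨ.differentiableAt (hU.mem_nhds hx)).hasDerivAt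
    have hΨ2 : ∀ x ∈ U, HasDerivAt (deriv Ψ) (Q x * Ψ x) x := fun x hx => by
      rw [← hode x hx]
      exact ((hΨ.deriv hU).differentiableAt (hU.mem_nhds hx)).hasDerivAt
    -- The Wronskian `N` of `w` and `Ψ` and the quantity `k = w² t'` are constant, so `(Ψ / w)' = N
    -- / w² = (N / k) t'`.
    obtain ⟨N, hN⟩ := hconst (fun x => deriv Ψ x * w x - Ψ x * w' x) fun x hx =>
      (((hΨ2 x hx).fun_mul (hw x hx)).fun_sub ((hΨ1 x hx).fun_mul (hw' x hx))).congr_deriv (by ring)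
    obtain ⟨k, hk⟩ := hconst (fun x => w x ^ 2 * t' x) fun x hx =>
      (((hw x hx).fun_pow 2).fun_mul (ht' x hx)).congr_deriv (by
        push_cast
        linear_combination w x * hwt x hx)
    have hk0 : k ≠ 0 := by
      rw [← hk x₀ hx₀]
      exact mul_ne_zero (pow_ne_zero 2 (hw0 x₀ hx₀)) (ht0 x₀ hx₀)
    obtain ⟨B, hB⟩ := hconst (fun x => Ψ x / w x - N / k * t x) fun x hx => by
      refine (((hΨ1 x hx).fun_div (hw x hx) (hw0 x hx)).fun_sub
        ((ht x hx).const_mul (N / k))).congr_deriv ?_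
      have := hw0 x hx
      field_simp
      linear_combination k * hN x hx - N * hk x hx
    refine ⟨(N / k, B), fun x hx => ?_, ?_⟩
    · have := hw0 x hx
      rw [← hB x hx]
      field_simp
      ring
    · rintro ⟨A', B'⟩ h'
      have key : ∀ x ∈ U, (A' - N / k) * t x + (B' - B) = 0 := fun x hx => by
        have h1 := h' x hx
        have h2 := hB x hx
        have := hw0 x hx
        simp only at h1 h2
        rw [h1, mul_div_cancel_left₀ _ this] at h2
        linear_combination h2
      have hd : HasDerivAt (fun x => (A' - N / k) * t x + (B' - B)) ((A' - N / k) * t' x₀) x₀ :=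
        ((ht x₀ hx₀).const_mul _).add_const _
      have hz : (fun x => (A' - N / k) * t x + (B' - B)) =ᶠ[𝓝 x₀] fun _ => 0 := by
        filter_upwards [hU.mem_nhds hx₀] with z hz using key z hz
      have h0 := hd.unique ((hasDerivAt_const x₀ (0 : ℂ)).congr_of_eventuallyEq hz)
      have hA : A' - N / k = 0 := (mul_eq_zero.mp h0).resolve_right (ht0 x₀ hx₀)
      have hB' := key x₀ hx₀
      rw [hA, zero_mul, zero_add] at hB'
      exact Prod.ext (sub_eq_zero.mp hA) (sub_eq_zero.mp hB')

end ReductionOfOrder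

/-! ### The Fuchsian equation and its general solution. -/

section FuchsianEquation

local notation "e" => halfPeriodValue

/-- Where `x⁴ = 5` the definition of a root branch prescribes no value; continuity extends the
identity to these isolated points. -/
theorem IsRootBranch.sq_eq {U : Set ℂ} (hU : IsOpen U) (hS : ∀ x ∈ U, x ^ 5 - x ≠ 0)
    {t w : ℂ → ℂ} (ht : IsInverseBranch U t) (hw : IsRootBranch U t w)
    (him : ∀ x ∈ U, 0 < (t x).im) {x : ℂ} (hx : x ∈ U) :
    w x ^ 2 = (e 0 (t x) - e 2 (t x)) * (x * (x ^ 2 - 1)) / (3 * (x ^ 2 + 1)) := by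
  have hgen : ∀ z ∈ U, z ^ 4 ≠ 5 →
      w z ^ 2 = (e 0 (t z) - e 2 (t z)) * (z * (z ^ 2 - 1)) / (3 * (z ^ 2 + 1)) := by
    intro z hz hz4
    obtain ⟨r, s, hr, hs, hwz⟩ := hw.root z hz hz4
    rw [hwz, mul_pow, hr, hs, root_product_eq (ht.im_ne z hz) (ht.inv z hz) hz4]
  obtain ⟨h0, -, h2⟩ := factors_ne_zero (hS x hx)
  have hd : ∀ i, ContinuousAt (fun x => e i (t x)) x := fun i =>
    ((hasDerivAt_halfPeriodValue i (him x hx)).differentiableAt.comp x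
      (ht.holo.differentiableAt (hU.mem_nhds hx))).continuousAt
  have hl : ContinuousAt (fun z => w z ^ 2) x :=
    (hw.holo.differentiableAt (hU.mem_nhds hx)).continuousAt.pow 2
  have hr : ContinuousAt (fun z => (e 0 (t z) - e 2 (t z)) * (z * (z ^ 2 - 1)) / (3 * (z ^ 2 + 1)))
      x := (((hd 0).sub (hd 2)).mul (by fun_prop)).div (by fun_prop) (mul_ne_zero three_ne_zero h2)
  have hne : ∀ᶠ z in 𝓝[≠] x, z ^ 4 ≠ 5 := (hasDerivAt_pow 4 x).eventually_ne (by simpa using h0)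
  refine tendsto_nhds_unique_of_eventuallyEq (l := 𝓝[≠] x) (hl.tendsto.mono_left nhdsWithin_le_nhds)
    (hr.tendsto.mono_left nhdsWithin_le_nhds) ?_
  filter_upwards [hne, nhdsWithin_le_nhds (hU.mem_nhds hx)] with z hz hzU using hgen z hzU hz

theorem fuchs_general_solution_of_im_pos {U : Set ℂ} (hU : IsOpen U) (hUc : IsConnected U)
    (hS : ∀ x ∈ U, x ^ 5 - x ≠ 0) {t w : ℂ → ℂ} (ht : IsInverseBranch U t)
    (hw : IsRootBranch U t w) (him : ∀ x ∈ U, 0 < (t x).im) :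
    (∀ A B : ℂ, IsFuchsSolution U fun x => w x * (A * t x + B)) ∧
      ∀ Ψ : ℂ → ℂ, IsFuchsSolution U Ψ →
        ∃! c : ℂ × ℂ, ∀ x ∈ U, Ψ x = w x * (c.1 * t x + c.2) := by
  obtain ⟨c, hc, hrel, hφ⟩ := exists_halphen_system
  set D : ℂ → ℂ := fun τ => e 0 τ - e 2 τ with hD
  set φ : ℂ → ℂ := fun τ => (deriv (e 0) τ - deriv (e 2) τ) / (e 0 τ - e 2 τ) with hφdef
  have hD0 : ∀ x ∈ U, D (t x) ≠ 0 := fun x hx =>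
    halfPeriodValue_sub_ne_zero (him x hx).ne' (by decide)
  -- The derivative of `t`, found by differentiating `λ(t(x)) = burnsideCover x`. With the formula
  -- for `w²` it gives `w² t₁ = 2 / (3c)`.
  set t₁ : ℂ → ℂ := fun x => 2 * (x ^ 2 + 1) / (c * D (t x) * (x * (x ^ 2 - 1))) with ht₁
  -- This is `-t'' / t'`, and `w' / w = G / 2` since `w² t'` is constant.
  set G : ℂ → ℂ := fun x => φ (t x) * t₁ x + (1 / x + 4 * x / (x ^ 4 - 1)) with hG
  have hx4 : ∀ x ∈ U, x ^ 4 - 1 ≠ 0 := fun x hx => by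
    obtain ⟨-, h1, h2⟩ := factors_ne_zero (hS x hx)
    have : x ^ 4 - 1 = (x ^ 2 - 1) * (x ^ 2 + 1) := by ring
    rw [this]
    exact mul_ne_zero h1 h2
  have htd : ∀ x ∈ U, HasDerivAt t (t₁ x) x := by
    intro x hx
    obtain ⟨h0, h1, h2⟩ := factors_ne_zero (hS x hx)
    have hlam := ht.modularLambda_eq hx
    have g1 := (hasDerivAt_modularLambda (him x hx) (hrel _ (him x hx))).comp x
      (ht.holo.differentiableAt (hU.mem_nhds hx)).hasDerivAt
    have g2 : modularLambda ∘ t =ᶠ[𝓝 x] burnsideCover := by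
      filter_upwards [hU.mem_nhds hx] with z hz using ht.modularLambda_eq hz
    have g3 := g1.unique ((hasDerivAt_burnsideCover h2).congr_of_eventuallyEq g2)
    have hd0 := hD0 x hx
    have g4 : deriv t x = t₁ x := by
      have g5 : c * modularLambda (t x) * (1 - modularLambda (t x)) * D (t x) ≠ 0 :=
        mul_ne_zero (mul_ne_zero (mul_ne_zero hc (modularLambda_ne_zero (him x hx).ne'))
          (sub_ne_zero.mpr (modularLambda_ne_one (him x hx).ne').symm)) hd0
      refine mul_left_cancel₀ g5 (g3.trans ?_)
      rw [hlam, burnsideCover]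
      simp only [ht₁]
      field_simp
      ring
    rw [← g4]
    exact (ht.holo.differentiableAt (hU.mem_nhds hx)).hasDerivAt
  have hDd : ∀ x ∈ U, HasDerivAt (fun x => D (t x)) (φ (t x) * D (t x) * t₁ x) x := by
    intro x hx
    have h := ((hasDerivAt_halfPeriodValue 0 (him x hx)).fun_sub
      (hasDerivAt_halfPeriodValue 2 (him x hx))).comp x (htd x hx)
    refine h.congr_deriv ?_
    have := hD0 x hx
    simp only [hφdef, hD] at this ⊢
    rw [div_mul_cancel₀ _ this]
  have ht₁0 : ∀ x ∈ U, t₁ x ≠ 0 := by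
    intro x hx
    obtain ⟨h0, h1, h2⟩ := factors_ne_zero (hS x hx)
    exact div_ne_zero (mul_ne_zero two_ne_zero h2)
      (mul_ne_zero (mul_ne_zero hc (hD0 x hx)) (mul_ne_zero h0 h1))
  have ht₁d : ∀ x ∈ U, HasDerivAt t₁ (-(t₁ x * G x)) x := by
    intro x hx
    obtain ⟨h0, h1, h2⟩ := factors_ne_zero (hS x hx)
    have hd0 := hD0 x hx
    have h4 := hx4 x hx
    have h := (((hasDerivAt_pow 2 x).add_const 1).const_mul 2).fun_div
      (((hDd x hx).const_mul c).fun_mul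
        ((hasDerivAt_id' x).fun_mul ((hasDerivAt_pow 2 x).sub_const 1)))
      (mul_ne_zero (mul_ne_zero hc hd0) (mul_ne_zero h0 h1))
    refine h.congr_deriv ?_
    have h4' : x ^ 4 - 1 = (x ^ 2 - 1) * (x ^ 2 + 1) := by ring
    simp only [hG, ht₁, h4']
    push_cast
    field_simp
    ring
  have hwsq : ∀ x ∈ U, w x ^ 2 = D (t x) * (x * (x ^ 2 - 1)) / (3 * (x ^ 2 + 1)) :=
    fun x hx => hw.sq_eq hU hS ht him hx
  have hw0 : ∀ x ∈ U, w x ≠ 0 := by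
    intro x hx h
    obtain ⟨h0, h1, h2⟩ := factors_ne_zero (hS x hx)
    have h3 := hwsq x hx
    rw [h, zero_pow two_ne_zero] at h3
    exact div_ne_zero (mul_ne_zero (hD0 x hx) (mul_ne_zero h0 h1)) (mul_ne_zero three_ne_zero h2)
      h3.symm
  have hwd : ∀ x ∈ U, HasDerivAt w (w x * G x / 2) x := by
    intro x hx
    obtain ⟨h0, h1, h2⟩ := factors_ne_zero (hS x hx)
    have hwx := (hw.holo.differentiableAt (hU.mem_nhds hx)).hasDerivAt
    have g1 := ((hDd x hx).fun_mul
      ((hasDerivAt_id' x).fun_mul ((hasDerivAt_pow 2 x).sub_const 1))).fun_div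
      (((hasDerivAt_pow 2 x).add_const 1).const_mul 3) (mul_ne_zero three_ne_zero h2)
    have g2 := hwx.fun_pow 2
    have g3 := g2.unique (g1.congr_of_eventuallyEq (by
      filter_upwards [hU.mem_nhds hx] with z hz using hwsq z hz))
    have g4 : deriv w x = w x * G x / 2 := by
      refine mul_left_cancel₀ (mul_ne_zero two_ne_zero (hw0 x hx)) ?_
      rw [show 2 * w x * deriv w x = (2 : ℕ) * w x ^ (2 - 1) * deriv w x by push_cast; ring, g3]
      have g6 : 2 * w x * (w x * G x / 2) = w x ^ 2 * G x := by ring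
      have h4 := hx4 x hx
      have h4' : x ^ 4 - 1 = (x ^ 2 - 1) * (x ^ 2 + 1) := by ring
      rw [g6, hwsq x hx]
      simp only [hG, h4']
      push_cast
      field_simp
      ring
    rwa [g4] at hwx
  have hGd : ∀ x ∈ U, HasDerivAt G ((φ (t x) ^ 2 / 2 + c ^ 2 / 2 *
      ((e 0 (t x) - e 1 (t x)) * (e 1 (t x) - e 2 (t x)))) * t₁ x * t₁ x +
      φ (t x) * -(t₁ x * G x) +
      (-1 / x ^ 2 + (4 * (x ^ 4 - 1) - 4 * x * (4 * x ^ 3)) / (x ^ 4 - 1) ^ 2)) x := by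
    intro x hx
    obtain ⟨h0, h1, h2⟩ := factors_ne_zero (hS x hx)
    have g1 := (hφ (t x) (him x hx)).comp x (htd x hx)
    have g2 := ((hasDerivAt_id' x).const_mul (4 : ℂ)).fun_div ((hasDerivAt_pow 4 x).sub_const 1)
      (hx4 x hx)
    have g3 := (hasDerivAt_const x (1 : ℂ)).fun_div (hasDerivAt_id' x) h0
    have g4 := (g1.fun_mul (ht₁d x hx)).fun_add (g3.fun_add g2)
    refine g4.congr_deriv ?_
    push_cast
    simp only [Function.comp_apply]
    ring
  set Q : ℂ → ℂ := fun x => -(1 / 4) * ((x ^ 8 + 14 * x ^ 4 + 1) / (x ^ 5 - x) ^ 2) with hQ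
  have key := reduction_of_order (Q := Q) hU hUc hwd (fun x hx => by
    -- Here `w'' / w = G² / 4 + G' / 2`. By the Riccati equation all terms in `φ` cancel; what
    -- remains is `hrat`, after `hM` expresses the quadratic term in the `eᵢ` through `x`.
    have g1 := ((hwd x hx).fun_mul (hGd x hx)).div_const 2
    refine g1.congr_deriv ?_
    obtain ⟨h0, h1, h2⟩ := factors_ne_zero (hS x hx)
    have h4 := hx4 x hx
    have h5 := hS x hx
    have hd0 := hD0 x hx
    have hprod : (e 0 (t x) - e 1 (t x)) * (e 1 (t x) - e 2 (t x)) =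
        D (t x) ^ 2 * (burnsideCover x * (1 - burnsideCover x)) := by
      rw [← ht.modularLambda_eq hx, modularLambda]
      simp only [hD] at hd0 ⊢
      field_simp
      ring
    have hM : c ^ 2 / 2 * ((e 0 (t x) - e 1 (t x)) * (e 1 (t x) - e 2 (t x))) * t₁ x * t₁ x =
        8 / (x ^ 2 + 1) ^ 2 := by
      rw [hprod, burnsideCover]
      simp only [ht₁]
      field_simp
      ring
    have hrat : (1 / x + 4 * x / (x ^ 4 - 1)) ^ 2 / 4 +
        (-1 / x ^ 2 + (4 * (x ^ 4 - 1) - 4 * x * (4 * x ^ 3)) / (x ^ 4 - 1) ^ 2) / 2 +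
        4 / (x ^ 2 + 1) ^ 2 = Q x := by
      have h4' : x ^ 4 - 1 = (x ^ 2 - 1) * (x ^ 2 + 1) := by ring
      have h5' : x ^ 5 - x = x * (x ^ 2 - 1) * (x ^ 2 + 1) := by ring
      simp only [hQ, h4', h5']
      field_simp
      ring
    rw [← hrat]
    simp only [hG]
    linear_combination (w x / 2) * hM) htd ht₁d (fun x hx => by ring) hw0 ht₁0
  exact ⟨fun A B => ⟨(key.1 A B).1, (key.1 A B).2⟩, fun Ψ hΨ => key.2 Ψ hΨ.holo hΨ.ode⟩

theorem fuchs_general_solution {U : Set ℂ} (hU : IsOpen U) (hUc : IsConnected U)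
    (hS : ∀ x ∈ U, x ^ 5 - x ≠ 0) {t w : ℂ → ℂ} (ht : IsInverseBranch U t)
    (hw : IsRootBranch U t w) :
    (∀ A B : ℂ, IsFuchsSolution U fun x => w x * (A * t x + B)) ∧
      ∀ Ψ : ℂ → ℂ, IsFuchsSolution U Ψ →
        ∃! c : ℂ × ℂ, ∀ x ∈ U, Ψ x = w x * (c.1 * t x + c.2) := by
  have hcont : ContinuousOn (fun x => (t x).im) U :=
    continuous_im.comp_continuousOn ht.holo.continuousOn
  -- On a connected `U` a branch stays in one half-plane. In the lower one `t` is replaced by `-t`,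
  -- which changes the sign of `A`.
  have hsign : (∀ x ∈ U, 0 < (t x).im) ∨ ∀ x ∈ U, (t x).im < 0 := by
    by_contra! h
    obtain ⟨⟨x, hx, hx0⟩, y, hy, hy0⟩ := h
    obtain ⟨z, hz, hz0⟩ := hUc.isPreconnected.intermediate_value hx hy hcont ⟨hx0, hy0⟩
    exact ht.im_ne z hz hz0
  rcases hsign with him | him
  · exact fuchs_general_solution_of_im_pos hU hUc hS ht hw him
  · obtain ⟨h1, h2⟩ := fuchs_general_solution_of_im_pos hU hUc hS ht.neg hw.neg
      fun x hx => by simpa using him x hx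
    refine ⟨fun A B => by simpa using h1 (-A) B, fun Ψ hΨ => ?_⟩
    obtain ⟨⟨A, B⟩, hAB, huniq⟩ := h2 Ψ hΨ
    refine ⟨(-A, B), fun x hx => by simpa using hAB x hx, ?_⟩
    rintro ⟨A', B'⟩ h
    have := huniq (-A', B') fun x hx => by simpa using h x hx
    simp only [Prod.mk.injEq] at this ⊢
    exact ⟨by rw [← this.1, neg_neg], this.2⟩

end FuchsianEquation

end BurnsideFunction

theorem proposition2 :
    -- the finite singular points are exactly the values omitted by Burnside's function
    (∀ x : ℂ, x ^ 5 - x ≠ 0 ↔ ∃ τ : ℂ, τ.im ≠ 0 ∧ burnsideX τ = x) ∧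
    -- on every simply connected domain without singular points, the inverse function has a unique
    -- branch through each preimage of each point, and the product of roots has a branch as well
    (∀ U : Set ℂ, IsOpen U → IsSimplyConnected U → (∀ x ∈ U, x ^ 5 - x ≠ 0) →
      ∀ x₀ ∈ U, ∀ τ₀ : ℂ, τ₀.im ≠ 0 → burnsideX τ₀ = x₀ →
        ∃ t : ℂ → ℂ, IsInverseBranch U t ∧ t x₀ = τ₀ ∧
          (∀ t' : ℂ → ℂ, IsInverseBranch U t' → t' x₀ = τ₀ → Set.EqOn t' t U) ∧
          ∃ w : ℂ → ℂ, IsRootBranch U t w) ∧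
    -- on any domain and for any choice of the branches, the formula gives the general solution
    (∀ U : Set ℂ, IsOpen U → IsConnected U → (∀ x ∈ U, x ^ 5 - x ≠ 0) →
      ∀ t w : ℂ → ℂ, IsInverseBranch U t → IsRootBranch U t w →
        (∀ A B : ℂ, IsFuchsSolution U (fun x => w x * (A * t x + B))) ∧
        (∀ Ψ : ℂ → ℂ, IsFuchsSolution U Ψ →
          ∃! c : ℂ × ℂ, ∀ x ∈ U, Ψ x = w x * (c.1 * t x + c.2))) := by
  exact ⟨ne_zero_iff_exists_burnsideX, fun U hU hsc hS x₀ hx₀ τ₀ hτ₀ h₀ => by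
    obtain ⟨t, ht, ht0, hw⟩ := exists_branches hU hsc hS hx₀ hτ₀ h₀
    exact ⟨t, ht, ht0, fun t' ht' ht'0 =>
      ht'.eqOn hsc.isPathConnected.isConnected.isPreconnected ht hx₀ (ht'0.trans ht0.symm), hw⟩,
    fun U hU hUc hS t w ht hw => fuchs_general_solution hU hUc hS ht hw⟩
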